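/- Let $x_0>0$, $T>0$, and let $K(x,t)=\frac{x}{2\sqrt{\pi}\,t^{3/2}}e^{-x^2/(4t)}$ for $t>0$ and $K(x,t)=0$ for $t=0$. Let $M[0,T]$ be the space of all $\phi\in C^\infty[0,T]$ with $\phi^{(n)}(0)=0$ for all $n\ge 0$. For $\nu\ge 0$ and $m=\lfloor\nu\rfloor$ put $${}_{RL}D^{\nu}\phi=\partial_t^{m+1}J^{m-\nu+1}\phi,\qquad {}_{C}D^{\nu}\phi=J^{m-\nu+1}\partial_t^{m+1}\phi,\qquad J^{\alpha}\phi(t)=\frac{1}{\Gamma(\alpha)}\int_0^t(t-\tau)^{\alpha-1}\phi(\tau)\,d\tau .$$ Let $g\in M[0,T]$, and let $u(x,t)$ be continuous in $t\in[0,T]$ for each $x\in[0,x_0)$ and satisfy $$\int_0^t K(x_0-x,t-\tau)\,u(x,\tau)\,d\tau=g(t),\qquad 0\le x<x_0,\ 0\le t\le T,$$ and put $u(x_0,t)=g(t)$ for $0\le t\le T$. Then: 1. For every integer $n\ge 0$, ${}_{RL}D^{n/2}g={}_{C}D^{n/2}g$ on $[0,T]$; write $\partial_t^{n/2}g$ for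 the common value. 2. (Heat flux at $x_0$.) For every $t\in[0,T]$, $u(\cdot,t)$ is differentiable on $(0,x_0)$ and has a left derivative at $x_0$, and $$\partial_xu(x,t)|_{x=x_0}=\lim_{x\to x_0^-}\partial_xu(x,t)=-\partial_t^{1/2}g(t).$$ 3. (Finite-bar Cauchy problem.) $u$ is continuous on $(0,x_0]\times[0,T]$ and solves $$\partial_x^2u=\partial_tu\ \ (0<x<x_0,\ 0\le t\le T),\qquad u(x_0,t)=g(t),\quad \partial_xu(x_0,t)=-\partial_t^{1/2}g(t)\ \ (0\le t\le T),\qquad u(x,0)=0\ \ (0<x<x_0),$$ where the derivatives at $x=x_0$, $t=0$ and $t=T$ are one-sided. 4. (Series.) The solution is given by $$u(x,t)=\sum_{n=0}^{\infty}\partial_t^{n/2}g(t)\,\frac{(x_0-x)^n}{n!}$$ at every $(x,t)\in[0,x_0)\times[0,T]$, $(x,t)\neq(0,0)$, at which the series converges; and the series does converge, absolutely and to $u(x,t)$, whenever $0\le x_0-x<x_0/\sqrt2$ and $0\le t\le T$. -/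

import Mathlib

open Set Filter Topology
open scoped ContDiff

noncomputable section

/-- The heat kernel `K(x,t) = x / (2 √π t^{3/2}) · e^{-x²/(4t)}` for `t > 0`, extended by `0`. -/
def heatK (x t : ℝ) : ℝ :=
  if 0 < t then x / (2 * Real.sqrt Real.pi * t ^ (3 / 2 : ℝ)) * Real.exp (-x ^ 2 / (4 * t)) else 0

/-- The space `M[0,T]`: smooth functions on `[0,T]` which vanish at `0` with all derivatives. -/
def MemM (T : ℝ) (φ : ℝ → ℝ) : Prop :=
  ContDiffOn ℝ ∞ φ (Icc 0 T) ∧ ∀ n : ℕ, iteratedDerivWithin n φ (Icc 0 T) 0 = 0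

/-- The fractional integral `J^α φ (t) = (1/Γ(α)) ∫_0^t (t-τ)^{α-1} φ(τ) dτ`, for `α > 0`. -/
def fracIntegral (α : ℝ) (φ : ℝ → ℝ) (t : ℝ) : ℝ :=
  (Real.Gamma α)⁻¹ * ∫ τ in (0 : ℝ)..t, (t - τ) ^ (α - 1) * φ τ

/-- The Riemann–Liouville derivative `∂_t^{m+1} (J^{m-ν+1} φ)` on `[0,T]`, where `m = ⌊ν⌋`
(for `ν = 0` this is `∂_t ∫_0^t φ`, so the identity on continuous functions). -/
def rlDeriv (T ν : ℝ) (φ : ℝ → ℝ) (t : ℝ) : ℝ :=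
  iteratedDerivWithin (⌊ν⌋₊ + 1) (fracIntegral (⌊ν⌋₊ - ν + 1) φ) (Icc 0 T) t

/-- The Caputo derivative `J^{m-ν+1} (∂_t^{m+1} φ)` on `[0,T]`, where `m = ⌊ν⌋`. -/
def caputoDeriv (T ν : ℝ) (φ : ℝ → ℝ) (t : ℝ) : ℝ :=
  fracIntegral (⌊ν⌋₊ - ν + 1) (iteratedDerivWithin (⌊ν⌋₊ + 1) φ (Icc 0 T)) t

/-- `u(x,·)` is continuous on `[0,T]` for every `x ∈ [0,x₀)`, and
`∫_0^t K(x₀-x,t-τ) u(x,τ) dτ = g(t)` for `0 ≤ x < x₀`, `0 ≤ t ≤ T`. -/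
structure SolvesVolterra (x₀ T : ℝ) (g : ℝ → ℝ) (u : ℝ → ℝ → ℝ) : Prop where
  cont : ∀ x ∈ Ico 0 x₀, ContinuousOn (u x) (Icc 0 T)
  eqn : ∀ x ∈ Ico 0 x₀, ∀ t ∈ Icc 0 T,
    ∫ τ in (0 : ℝ)..t, heatK (x₀ - x) (t - τ) * u x τ = g t

/-- The Cauchy problem of the finite bar between `0` and `x₀` with zero initial temperature,
temperature `g` and heat flux `f` at `x = x₀`. At `x₀` the `x`-derivative is the left one, and at
`t = 0`, `t = T` the `t`-derivative is one-sided. -/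
structure SolvesFiniteBar (x₀ T : ℝ) (g f : ℝ → ℝ) (u : ℝ → ℝ → ℝ) : Prop where
  cont : ContinuousOn (fun p : ℝ × ℝ => u p.1 p.2) (Ioc 0 x₀ ×ˢ Icc 0 T)
  diff : ∀ x ∈ Ioo 0 x₀, ∀ t ∈ Icc 0 T, DifferentiableAt ℝ (fun y => u y t) x
  heat : ∀ x ∈ Ioo 0 x₀, ∀ t ∈ Icc 0 T, ∃ c : ℝ,
    HasDerivAt (fun y => deriv (fun z => u z t) y) c x ∧
    HasDerivWithinAt (fun s => u x s) c (Icc 0 T) t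
  temp : ∀ t ∈ Icc 0 T, u x₀ t = g t
  flux : ∀ t ∈ Icc 0 T, HasDerivWithinAt (fun y => u y t) (f t) (Iic x₀) x₀
  init : ∀ x ∈ Ioo 0 x₀, u x 0 = 0

/-- The `n`-th term `∂_t^{n/2} g(t) · (x₀-x)^n / n!`. -/
def halfSeriesTerm (x₀ T : ℝ) (g : ℝ → ℝ) (x t : ℝ) (n : ℕ) : ℝ :=
  rlDeriv T ((n : ℝ) / 2) g t * (x₀ - x) ^ n / (n.factorial : ℝ)

end

/-!
Write `K_x = K(x,·)` and `v = u(0,·)`. The equation at `x = 0` says `g = K_{x₀} * v`. The kernels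
form a convolution semigroup, `K_a * K_b = K_{a+b}` (`integral_heatK_mul_heatK`), so
`K_{x₀-x} * (K_x * v) = g`, and since convolution with a positive kernel is injective
(`eq_zero_of_intervalIntegral_mul_eq_zero`, a special case of Titchmarsh's theorem), the solution
is the heat potential `u(x,·) = K_x * v` for `0 < x ≤ x₀` (`SolvesVolterra.eq_pot`). Everything
else is read off this formula.

Put `E(x,s) = (πs)^{-1/2} e^{-x²/(4s)}`, `k_n = (-∂_x)^n E` and `A_n(x,·) = k_n(x,·) * v`. Then
`K = k_1`, hence `u = A_1` and `g = A_1(x₀,·)`. The family satisfies `∂_x A_n = -A_{n+1}`,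
`∂_t A_n = A_{n+2}` (the heat equation) and `J^{1/2} A_{n+1} = A_n` (`fracIntegral_half_pot`). Consequently
both half-order derivatives of `g` are `∂_t^{n/2} g = A_{n+1}(x₀,·) = (-∂_x)^n u(x₀,·)`, which
gives their equality, the heat flux and the Cauchy problem. It also identifies the series with the
Taylor series of `u(·,t)` at `x₀`.

For complex `z` with `|arg z| < π/4` one has `Re z² > 0`, so the potentials are holomorphic in
this sector (`hasDerivAt_cpot_space`). The disc inscribed in it around `x₀` has radius `x₀/√2`,
and there the Taylor series converges to `u`. If the series converges at some other `x` in
`[0,x₀)`, it agrees with the potential on `(x,x₀)` by the identity theorem (`tsum_eq_pot`). Abel's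
theorem then gives its sum at `x` as the limit of the potential from the right, which is `u(x,t)`
by continuity if `x > 0`, and by the approximate identity `K_x → δ`
(`tendsto_pot_one_nhdsGT_zero`) if `x = 0 < t`.
-/

open MeasureTheory Convolution

/-! ### Hermite functions and the heat kernel family -/

/-- `He_{n+1}' = (n+1) He_n` for the probabilists' Hermite polynomials. -/
theorem derivative_hermite_succ (n : ℕ) :
    (Polynomial.hermite (n + 1)).derivative =
      ((n + 1 : ℕ) : Polynomial ℤ) * Polynomial.hermite n := by
  induction n with
  | zero => simp
  | succ n ih =>
    rw [Polynomial.hermite_succ (n + 1), Polynomial.derivative_sub, Polynomial.derivative_mul, ih,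
      Polynomial.derivative_mul, Polynomial.hermite_succ n]
    simp
    ring

/-- The Hermite function `ψ_n(y) = He_n(y) e^{-y²/2} = (-d/dy)^n e^{-y²/2}`. -/
noncomputable def hermiteFun (n : ℕ) (y : ℂ) : ℂ :=
  Polynomial.aeval y (Polynomial.hermite n) * Complex.exp (-y ^ 2 / 2)

theorem hasDerivAt_hermiteFun (n : ℕ) (y : ℂ) :
    HasDerivAt (hermiteFun n) (-hermiteFun (n + 1) y) y := by
  have h1 := (Polynomial.hermite n).hasDerivAt_aeval y
  have h2 : HasDerivAt (fun y : ℂ => Complex.exp (-y ^ 2 / 2))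
      (Complex.exp (-y ^ 2 / 2) * (-y)) y := by
    have : HasDerivAt (fun y : ℂ => -y ^ 2 / 2) (-y) y := by
      convert! ((hasDerivAt_pow 2 y).neg).div_const 2 using 1
      simp; ring
    exact this.cexp
  convert! h1.mul h2 using 1
  rw [hermiteFun, Polynomial.hermite_succ]
  simp
  ring

theorem hermiteFun_add_two (n : ℕ) (y : ℂ) :
    hermiteFun (n + 2) y = y * hermiteFun (n + 1) y - (n + 1) * hermiteFun n y := by
  simp only [hermiteFun]
  rw [Polynomial.hermite_succ (n + 1), derivative_hermite_succ]
  simp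
  ring

/-- The heat kernel family: for `s > 0`,
`hk n z s = (-∂_z)^n ((πs)^{-1/2} e^{-z²/(4s)}) = √(2/π) r^{n+1} ψ_n(z r)` with `r = (2s)^{-1/2}`.
For `s ≤ 0` the convention `0⁻¹ = 0` gives `r = 0`, hence the value `0`, which is the one wanted. -/
noncomputable def hk (n : ℕ) (z : ℂ) (s : ℝ) : ℂ :=
  (√(2 / Real.pi) * (√(2 * s))⁻¹ ^ (n + 1) : ℝ) * hermiteFun n (z * ((√(2 * s))⁻¹ : ℝ))

theorem hk_of_nonpos (n : ℕ) (z : ℂ) {s : ℝ} (hs : s ≤ 0) : hk n z s = 0 := by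
  have : √(2 * s) = 0 := Real.sqrt_eq_zero_of_nonpos (by linarith)
  simp [hk, this]

theorem hasDerivAt_hk_space (n : ℕ) (z : ℂ) (s : ℝ) :
    HasDerivAt (fun z => hk n z s) (-hk (n + 1) z s) z := by
  have h1 : HasDerivAt (fun z : ℂ => z * ((√(2 * s))⁻¹ : ℝ)) ((√(2 * s))⁻¹ : ℝ) z := by
    simpa using (hasDerivAt_id z).mul_const (((√(2 * s))⁻¹ : ℝ) : ℂ)
  have h2 := ((hasDerivAt_hermiteFun n _).comp z h1).const_mul
    ((√(2 / Real.pi) * (√(2 * s))⁻¹ ^ (n + 1) : ℝ) : ℂ)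
  convert! h2 using 1
  simp only [hk]
  push_cast
  ring

/-- For `s > 0`, every member of the family solves the heat equation
`∂_s hk_n = ∂_z² hk_n`. -/
theorem hasDerivAt_hk_time_of_pos (n : ℕ) (z : ℂ) {s : ℝ} (hs : 0 < s) :
    HasDerivAt (hk n z) (hk (n + 2) z s) s := by
  have hq : 0 < √(2 * s) := Real.sqrt_pos.2 (by linarith)
  have hr : HasDerivAt (fun s => (√(2 * s))⁻¹) (-(√(2 * s))⁻¹ ^ 3) s := by
    have h := (((hasDerivAt_id s).const_mul 2).sqrt (by simp; linarith)).inv (by simpa using hq.ne')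
    convert! h using 1
    simp
    field_simp
  have hrC := hr.ofReal_comp
  have h1 := ((hasDerivAt_hermiteFun n (z * ((√(2 * s))⁻¹ : ℝ))).comp s
    (hrC.const_mul z))
  have h2 := (((hr.pow (n + 1)).const_mul (√(2 / Real.pi))).ofReal_comp).mul h1
  convert! h2 using 1
  simp only [hk, hermiteFun_add_two, Function.comp]
  simp
  ring

/-! ### The sector of holomorphy and uniform bounds -/

/-- Each `r^k e^{-cr²}` is bounded. -/
theorem exists_pow_mul_exp_neg_sq_le (k : ℕ) {c : ℝ} (hc : 0 < c) :
    ∃ C : ℝ, ∀ r : ℝ, 0 ≤ r → r ^ k * Real.exp (-(c * r ^ 2)) ≤ C := by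
  refine ⟨1 + k.factorial / c ^ k, fun r hr => ?_⟩
  have h1 : r ^ k ≤ 1 + (r ^ 2) ^ k := by
    rw [← pow_mul, mul_comm, pow_mul]
    nlinarith [sq_nonneg (r ^ k - 1), sq_nonneg (r ^ k), pow_nonneg hr k]
  have h2 := Real.pow_div_factorial_le_exp (x := c * r ^ 2) (by positivity) k
  have h3 : Real.exp (-(c * r ^ 2)) ≤ 1 := Real.exp_le_one_iff.2 (by nlinarith [sq_nonneg r])
  have h4 : (r ^ 2) ^ k * Real.exp (-(c * r ^ 2)) ≤ k.factorial / c ^ k := by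
    rw [Real.exp_neg, ← div_eq_mul_inv, div_le_div_iff₀ (Real.exp_pos _) (by positivity)]
    rw [div_le_iff₀ (by positivity), mul_pow] at h2
    linarith
  calc r ^ k * Real.exp (-(c * r ^ 2)) ≤ (1 + (r ^ 2) ^ k) * Real.exp (-(c * r ^ 2)) := by gcongr
    _ = Real.exp (-(c * r ^ 2)) + (r ^ 2) ^ k * Real.exp (-(c * r ^ 2)) := by ring
    _ ≤ _ := by gcongr

theorem exists_norm_aeval_mul_le (p : Polynomial ℤ) (k : ℕ) (R : ℝ) {c : ℝ} (hc : 0 < c) :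
    ∃ C : ℝ, 0 ≤ C ∧ ∀ r : ℝ, 0 ≤ r → ∀ z : ℂ, ‖z‖ ≤ R →
      ‖Polynomial.aeval (z * (r : ℂ)) p‖ * (r ^ k * Real.exp (-(c * r ^ 2))) ≤ C := by
  induction p using Polynomial.induction_on' with
  | add p q hp hq =>
    obtain ⟨C, hC, h⟩ := hp
    obtain ⟨D, hD, h'⟩ := hq
    refine ⟨C + D, by positivity, fun r hr z hz => ?_⟩
    rw [map_add]
    calc _ ≤ (‖Polynomial.aeval (z * (r : ℂ)) p‖ + ‖Polynomial.aeval (z * (r : ℂ)) q‖) *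
          (r ^ k * Real.exp (-(c * r ^ 2))) := by gcongr; exact norm_add_le _ _
      _ ≤ C + D := by rw [add_mul]; exact add_le_add (h r hr z hz) (h' r hr z hz)
  | monomial m a =>
    obtain ⟨C, h⟩ := exists_pow_mul_exp_neg_sq_le (m + k) hc
    have hC : 0 ≤ C := le_trans (by positivity) (h 0 le_rfl)
    refine ⟨‖(a : ℂ)‖ * |R| ^ m * C, by positivity, fun r hr z hz => ?_⟩
    rw [Polynomial.aeval_monomial]
    simp only [eq_intCast, norm_mul, norm_pow, Complex.norm_real, Real.norm_eq_abs,
      abs_of_nonneg hr, mul_pow]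
    calc _ = ‖(a : ℂ)‖ * ‖z‖ ^ m * (r ^ (m + k) * Real.exp (-(c * r ^ 2))) := by rw [pow_add]; ring
      _ ≤ _ := by
        gcongr
        · exact hz.trans (le_abs_self R)
        · exact h r hr

/-- Uniformly for `z` bounded with `Re z²` bounded below, `hk n z s` is bounded by any
power of `s`. -/
theorem exists_norm_hk_mul_le (n k : ℕ) (R : ℝ) {δ : ℝ} (hδ : 0 < δ) :
    ∃ C : ℝ, 0 ≤ C ∧ ∀ z : ℂ, ‖z‖ ≤ R → δ ≤ (z ^ 2).re → ∀ s : ℝ,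
      ‖hk n z s‖ * (√(2 * s))⁻¹ ^ k ≤ C := by
  obtain ⟨C, hC, h⟩ := exists_norm_aeval_mul_le (Polynomial.hermite n) (n + 1 + k) R
    (half_pos hδ)
  refine ⟨√(2 / Real.pi) * C, by positivity, fun z hz hz2 s => ?_⟩
  set r := (√(2 * s))⁻¹ with hr
  have hr0 : 0 ≤ r := by positivity
  have he : ‖Complex.exp (-(z * (r : ℂ)) ^ 2 / 2)‖ ≤ Real.exp (-(δ / 2 * r ^ 2)) := by
    rw [Complex.norm_exp]
    apply Real.exp_le_exp.2
    have : -(z * (r : ℂ)) ^ 2 / 2 = ((r ^ 2 / 2 : ℝ) : ℂ) * (-z ^ 2) := by push_cast; ring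
    rw [this, Complex.re_ofReal_mul, Complex.neg_re]
    nlinarith [sq_nonneg r]
  calc ‖hk n z s‖ * r ^ k
      = √(2 / Real.pi) * (‖Polynomial.aeval (z * (r : ℂ)) (Polynomial.hermite n)‖ *
        (r ^ (n + 1 + k) * ‖Complex.exp (-(z * (r : ℂ)) ^ 2 / 2)‖)) := by
        rw [hk, hermiteFun, norm_mul, norm_mul, Complex.norm_real,
          Real.norm_of_nonneg (by positivity), pow_add]
        ring
    _ ≤ _ := by
      gcongr
      refine le_trans ?_ (h r hr0 z hz)
      gcongr

/-- The sector `|arg z| < π/4`, on which `Re z² > 0`. -/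
def quarterSector : Set ℂ := {z | |z.im| < z.re}

theorem isOpen_quarterSector : IsOpen quarterSector :=
  isOpen_lt (by fun_prop) Complex.continuous_re

theorem ofReal_mem_quarterSector {x : ℝ} (hx : 0 < x) : (x : ℂ) ∈ quarterSector := by
  simpa [quarterSector] using hx

theorem convex_quarterSector : Convex ℝ quarterSector := by
  intro z hz w hw a b ha hb hab
  simp only [quarterSector, mem_ofPred_eq] at *
  simp only [Complex.add_im, Complex.add_re, Complex.smul_im, Complex.smul_re, smul_eq_mul]
  rw [abs_lt] at *
  rcases ha.eq_or_lt with rfl | ha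
  · obtain rfl : b = 1 := by linarith
    constructor <;> linarith
  · constructor <;> nlinarith

theorem re_sq_pos_of_mem {z : ℂ} (hz : z ∈ quarterSector) : 0 < (z ^ 2).re := by
  simp only [quarterSector, mem_ofPred_eq, abs_lt] at hz
  simp only [pow_two, Complex.mul_re]
  nlinarith

/-- The disc inscribed in the sector around a real `x` has radius `x / √2`. -/
theorem ball_subset_quarterSector {x : ℝ} :
    Metric.ball (x : ℂ) (x / √2) ⊆ quarterSector := by
  intro z hz
  rw [Metric.mem_ball, dist_eq_norm, lt_div_iff₀ (by positivity)] at hz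
  have h : (‖z - x‖ * √2) ^ 2 < x ^ 2 := by
    have : 0 ≤ ‖z - x‖ * √2 := by positivity
    gcongr
  rw [mul_pow, Complex.sq_norm, Complex.normSq_apply, Real.sq_sqrt (by norm_num)] at h
  have hx : 0 < x := lt_of_le_of_lt (by positivity) hz
  simp only [quarterSector, mem_ofPred_eq]
  simp at h
  have hre : 0 < z.re := by nlinarith [sq_nonneg (2 * z.re - x), sq_nonneg z.im]
  apply abs_lt_of_sq_lt_sq _ hre.le
  nlinarith [sq_nonneg (2 * z.re - x)]

theorem exists_eventually_norm_hk_mul_le (n k : ℕ) {z₀ : ℂ} (hz : z₀ ∈ quarterSector) :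
    ∃ C : ℝ, 0 ≤ C ∧ ∀ᶠ z in 𝓝 z₀, ∀ s : ℝ, ‖hk n z s‖ * (√(2 * s))⁻¹ ^ k ≤ C := by
  obtain ⟨C, hC, h⟩ := exists_norm_hk_mul_le n k (‖z₀‖ + 1) (half_pos (re_sq_pos_of_mem hz))
  refine ⟨C, hC, ?_⟩
  have h1 : ∀ᶠ z in 𝓝 z₀, ‖z‖ < ‖z₀‖ + 1 :=
    continuous_norm.continuousAt.eventually_lt continuousAt_const (by linarith)
  have h2 : ∀ᶠ z in 𝓝 z₀, (z₀ ^ 2).re / 2 < (z ^ 2).re := by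
    refine continuousAt_const.eventually_lt (f := fun _ => (z₀ ^ 2).re / 2)
      (g := fun z : ℂ => (z ^ 2).re) (by fun_prop) ?_
    linarith [re_sq_pos_of_mem hz]
  filter_upwards [h1, h2] with z hz1 hz2 s using h z hz1.le hz2.le s

theorem exists_eventually_norm_hk_le (n : ℕ) {z₀ : ℂ} (hz : z₀ ∈ quarterSector) :
    ∃ C : ℝ, 0 ≤ C ∧ ∀ᶠ z in 𝓝 z₀, ∀ s : ℝ, ‖hk n z s‖ ≤ C := by
  simpa using exists_eventually_norm_hk_mul_le n 0 hz

theorem exists_norm_hk_le (n : ℕ) {z : ℂ} (hz : z ∈ quarterSector) :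
    ∃ C : ℝ, 0 ≤ C ∧ ∀ s : ℝ, ‖hk n z s‖ ≤ C := by
  obtain ⟨C, hC, h⟩ := exists_eventually_norm_hk_le n hz
  exact ⟨C, hC, h.self_of_nhds⟩

/-- For `z` in the sector the kernels are smooth across `s = 0`, and the heat equation
`∂_s hk_n = hk_{n+2}` holds on the whole line. -/
theorem hasDerivAt_hk_time (n : ℕ) {z : ℂ} (hz : z ∈ quarterSector) (s : ℝ) :
    HasDerivAt (hk n z) (hk (n + 2) z s) s := by
  rcases lt_trichotomy s 0 with hs | rfl | hs
  · rw [hk_of_nonpos _ _ hs.le]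
    refine (hasDerivAt_const s (0 : ℂ)).congr_of_eventuallyEq ?_
    filter_upwards [gt_mem_nhds hs] with t ht using hk_of_nonpos _ _ ht.le
  · rw [hk_of_nonpos _ _ le_rfl, hasDerivAt_iff_isLittleO_nhds_zero]
    -- the bound with the exponent `4` says that `hk n z s = O(s²)`
    obtain ⟨C, hC, h⟩ := exists_eventually_norm_hk_mul_le n 4 hz
    have h := h.self_of_nhds
    have : (fun s : ℝ => hk n z s) =O[𝓝 0] fun s : ℝ => s ^ 2 := by
      refine Asymptotics.IsBigO.of_bound (4 * C) (Eventually.of_forall fun s => ?_)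
      rcases le_or_gt s 0 with hs | hs
      · rw [hk_of_nonpos _ _ hs, norm_zero]; positivity
      · have h' := h s
        have hq : √(2 * s) ^ 4 = 4 * s ^ 2 := by
          rw [show 4 = 2 * 2 from rfl, pow_mul, Real.sq_sqrt (by linarith)]; ring
        rw [inv_pow, hq, ← div_eq_mul_inv, div_le_iff₀ (by positivity)] at h'
        rw [Real.norm_of_nonneg (by positivity)]
        linarith
    simp only [zero_add, hk_of_nonpos n z le_rfl, sub_zero, smul_zero]
    refine this.trans_isLittleO ?_
    simpa using Asymptotics.isLittleO_pow_pow (𝕜 := ℝ) (show 1 < 2 by norm_num)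
  · exact hasDerivAt_hk_time_of_pos n z hs

theorem continuous_hk (n : ℕ) {z : ℂ} (hz : z ∈ quarterSector) : Continuous (hk n z) :=
  continuous_iff_continuousAt.2 fun s => (hasDerivAt_hk_time n hz s).continuousAt

/-! ### The kernel at real points -/

theorem hk_zero_ofReal (x : ℝ) {s : ℝ} (hs : 0 < s) :
    hk 0 x s = ((√Real.pi)⁻¹ * (√s)⁻¹ * Real.exp (-x ^ 2 / (4 * s)) : ℝ) := by
  have h1 : √2 ≠ 0 := by positivity
  have h2 : √s ≠ 0 := by positivity
  have h3 : √Real.pi ≠ 0 := by positivity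
  simp only [hk, hermiteFun, Polynomial.hermite_zero]
  rw [Real.sqrt_div (by norm_num), Real.sqrt_mul (by norm_num)]
  simp only [map_one, one_mul]
  have : -((x : ℂ) * (((√2 * √s)⁻¹ : ℝ) : ℂ)) ^ 2 / 2 = ((-x ^ 2 / (4 * s) : ℝ) : ℂ) := by
    norm_cast
    rw [mul_pow, inv_pow, mul_pow, Real.sq_sqrt (by norm_num), Real.sq_sqrt hs.le]
    field_simp
    norm_num
  rw [this, ← Complex.ofReal_exp, ← Complex.ofReal_mul]
  congr 1
  rw [zero_add, pow_one]
  field_simp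

theorem heatK_of_pos (x : ℝ) {s : ℝ} (hs : 0 < s) :
    heatK x s = x / (2 * √Real.pi * (s * √s)) * Real.exp (-x ^ 2 / (4 * s)) := by
  have h32 : s ^ (3 / 2 : ℝ) = s * √s := by
    rw [Real.sqrt_eq_rpow, show (3 / 2 : ℝ) = 1 + 1 / 2 by norm_num,
      Real.rpow_add hs, Real.rpow_one]
  rw [heatK, if_pos hs, h32]

theorem hk_one_ofReal (x s : ℝ) : hk 1 x s = (heatK x s : ℝ) := by
  rcases le_or_gt s 0 with hs | hs
  · simp [hk_of_nonpos _ _ hs, heatK, hs.not_gt]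
  have h0 := hk_zero_ofReal x hs
  have h2 : √s ≠ 0 := by positivity
  have h3 : √Real.pi ≠ 0 := by positivity
  have h1 : hk 1 x s = ((x / (2 * s) : ℝ) : ℂ) * hk 0 x s := by
    simp only [hk, hermiteFun, Polynomial.hermite_zero, Polynomial.hermite_one]
    simp only [map_one, one_mul, Polynomial.aeval_X, zero_add, pow_one]
    have : ((x / (2 * s) : ℝ) : ℂ) = ((x * (√(2 * s))⁻¹ ^ 2 : ℝ) : ℂ) := by
      rw [inv_pow, Real.sq_sqrt (by linarith), div_eq_mul_inv]
    rw [this]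
    push_cast
    ring
  rw [h1, h0, ← Complex.ofReal_mul]
  congr 1
  rw [heatK_of_pos x hs]
  field_simp

/-! ### Potentials -/

/-- The potential of the density `V` with kernel `hk n z`. -/
noncomputable def cpot (V : ℝ → ℝ) (n : ℕ) (z : ℂ) (t : ℝ) : ℂ :=
  ∫ τ, (V τ : ℂ) * hk n z (t - τ)

/-- The kernel `hk n` at real points, as a real function. -/
noncomputable def rk (n : ℕ) (x s : ℝ) : ℝ := (hk n x s).re

/-- The potential `cpot` at real points, as a real function. -/
noncomputable def pot (V : ℝ → ℝ) (n : ℕ) (x t : ℝ) : ℝ :=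
  ∫ τ, V τ * rk n x (t - τ)

theorem ofReal_rk (n : ℕ) (x s : ℝ) : (rk n x s : ℂ) = hk n x s := by
  have : (starRingEnd ℂ) (hk n x s) = hk n x s := by
    have h1 : ((x : ℂ) * (((√(2 * s))⁻¹ : ℝ) : ℂ)) = ((x * (√(2 * s))⁻¹ : ℝ) : ℂ) := by
      push_cast; ring
    have h2 : ∀ (y : ℝ) (p : Polynomial ℤ),
        Polynomial.aeval (y : ℂ) p = ((Polynomial.aeval y p : ℝ) : ℂ) := fun y p => by
      simpa using (Polynomial.aeval_algebraMap_apply ℂ y p)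
    have h3 : ∀ y : ℝ, -(y : ℂ) ^ 2 / 2 = ((-y ^ 2 / 2 : ℝ) : ℂ) := fun y => by push_cast; ring
    rw [hk, hermiteFun, h1, h2, h3, ← Complex.ofReal_exp, ← Complex.ofReal_mul,
      ← Complex.ofReal_mul, Complex.conj_ofReal]
  exact Complex.conj_eq_iff_re.1 this

theorem rk_of_nonpos (n : ℕ) (x : ℝ) {s : ℝ} (hs : s ≤ 0) : rk n x s = 0 := by
  simp [rk, hk_of_nonpos _ _ hs]

theorem rk_one (x s : ℝ) : rk 1 x s = heatK x s := by
  rw [rk, hk_one_ofReal, Complex.ofReal_re]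

theorem continuous_rk (n : ℕ) {x : ℝ} (hx : 0 < x) : Continuous (rk n x) :=
  Complex.continuous_re.comp (continuous_hk n (ofReal_mem_quarterSector hx))

theorem exists_abs_rk_le (n : ℕ) {x : ℝ} (hx : 0 < x) : ∃ C : ℝ, 0 ≤ C ∧ ∀ s, |rk n x s| ≤ C := by
  obtain ⟨C, hC, h⟩ := exists_norm_hk_le n (ofReal_mem_quarterSector hx)
  exact ⟨C, hC, fun s => (Complex.abs_re_le_norm _).trans (h s)⟩

theorem hasDerivAt_rk_space (n : ℕ) (x s : ℝ) :
    HasDerivAt (fun y => rk n y s) (-rk (n + 1) x s) x := by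
  simpa [rk] using (hasDerivAt_hk_space n x s).real_of_complex

theorem exists_eventually_abs_rk_le (n : ℕ) {x : ℝ} (hx : 0 < x) :
    ∃ C : ℝ, 0 ≤ C ∧ ∀ᶠ y in 𝓝 x, ∀ s, |rk n y s| ≤ C := by
  obtain ⟨C, hC, h⟩ := exists_eventually_norm_hk_le n (ofReal_mem_quarterSector hx)
  refine ⟨C, hC, ?_⟩
  filter_upwards [Complex.continuous_ofReal.continuousAt.eventually h] with y hy s
  exact (Complex.abs_re_le_norm _).trans (hy s)

theorem cpot_ofReal (V : ℝ → ℝ) (n : ℕ) (x t : ℝ) : cpot V n x t = pot V n x t := by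
  rw [cpot, pot]
  refine Eq.trans ?_ (integral_ofReal (𝕜 := ℂ))
  simp [← ofReal_rk]

section
variable {V : ℝ → ℝ} (hV : Integrable V)
include hV

theorem integrable_mul_hk (n : ℕ) {z : ℂ} (hz : z ∈ quarterSector) (t : ℝ) :
    Integrable (fun τ => (V τ : ℂ) * hk n z (t - τ)) := by
  obtain ⟨C, hC, h⟩ := exists_norm_hk_le n hz
  refine hV.ofReal.mul_bdd (c := C) ?_ (Eventually.of_forall fun τ => h _)
  have := continuous_hk n hz
  exact (by fun_prop : Continuous fun τ => hk n z (t - τ)).aestronglyMeasurable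

theorem hasDerivAt_cpot_space (n : ℕ) {z : ℂ} (hz : z ∈ quarterSector) (t : ℝ) :
    HasDerivAt (fun z => cpot V n z t) (-cpot V (n + 1) z t) z := by
  obtain ⟨C, hC, h⟩ := exists_eventually_norm_hk_le (n + 1) hz
  have := (hasDerivAt_integral_of_dominated_loc_of_deriv_le (μ := volume)
    (F := fun z τ => (V τ : ℂ) * hk n z (t - τ))
    (F' := fun z τ => -((V τ : ℂ) * hk (n + 1) z (t - τ))) (bound := fun τ => ‖V τ‖ * C) h
    ?_ (integrable_mul_hk hV n hz t) (integrable_mul_hk hV (n + 1) hz t).neg.aestronglyMeasurable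
    (Eventually.of_forall fun τ z hz => ?_) (hV.norm.mul_const C)
    (Eventually.of_forall fun τ z hz => ?_)).2
  · rwa [integral_neg] at this
  · filter_upwards [isOpen_quarterSector.mem_nhds hz] with w hw
    exact (integrable_mul_hk hV n hw t).aestronglyMeasurable
  · rw [norm_neg, norm_mul, Complex.norm_real]
    gcongr
    exact hz _
  · simpa using (hasDerivAt_hk_space n z (t - τ)).const_mul (V τ : ℂ)

theorem hasDerivAt_cpot_time (n : ℕ) {z : ℂ} (hz : z ∈ quarterSector) (t : ℝ) :
    HasDerivAt (cpot V n z) (cpot V (n + 2) z t) t := by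
  obtain ⟨C, hC, h⟩ := exists_norm_hk_le (n + 2) hz
  exact (hasDerivAt_integral_of_dominated_loc_of_deriv_le (μ := volume) (s := univ)
    (F := fun t τ => (V τ : ℂ) * hk n z (t - τ))
    (F' := fun t τ => (V τ : ℂ) * hk (n + 2) z (t - τ)) (bound := fun τ => ‖V τ‖ * C) univ_mem
    (Eventually.of_forall fun t => (integrable_mul_hk hV n hz t).aestronglyMeasurable)
    (integrable_mul_hk hV n hz t) (integrable_mul_hk hV (n + 2) hz t).aestronglyMeasurable
    (Eventually.of_forall fun τ t _ => by
      rw [norm_mul, Complex.norm_real]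
      gcongr
      exact h _) (hV.norm.mul_const C)
    (Eventually.of_forall fun τ t _ =>
      ((hasDerivAt_hk_time n hz (t - τ)).comp_sub_const t τ).const_mul (V τ : ℂ))).2

theorem hasDerivAt_pot_space (n : ℕ) {x : ℝ} (hx : 0 < x) (t : ℝ) :
    HasDerivAt (fun x => pot V n x t) (-pot V (n + 1) x t) x := by
  simpa [cpot_ofReal] using
    (hasDerivAt_cpot_space hV n (ofReal_mem_quarterSector hx) t).real_of_complex

theorem hasDerivAt_pot_time (n : ℕ) {x : ℝ} (hx : 0 < x) (t : ℝ) :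
    HasDerivAt (pot V n x) (pot V (n + 2) x t) t := by
  have := Complex.reCLM.hasFDerivAt.comp_hasDerivAt t
    (hasDerivAt_cpot_time hV n (ofReal_mem_quarterSector hx) t)
  simpa [Function.comp_def, cpot_ofReal] using this

theorem continuous_pot (n : ℕ) {x : ℝ} (hx : 0 < x) : Continuous (pot V n x) :=
  continuous_iff_continuousAt.2 fun t => (hasDerivAt_pot_time hV n hx t).continuousAt

theorem exists_eventually_abs_pot_le (n : ℕ) {x : ℝ} (hx : 0 < x) :
    ∃ C : ℝ, 0 ≤ C ∧ ∀ᶠ y in 𝓝 x, ∀ t, |pot V n y t| ≤ C := by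
  obtain ⟨C, hC, h⟩ := exists_eventually_abs_rk_le n hx
  refine ⟨∫ τ, ‖V τ‖ * C, by positivity, ?_⟩
  filter_upwards [h] with y hy t
  rw [pot, ← Real.norm_eq_abs]
  refine norm_integral_le_of_norm_le (hV.norm.mul_const C) (Eventually.of_forall fun τ => ?_)
  rw [norm_mul]
  gcongr
  exact hy _

theorem continuousAt_pot (n : ℕ) {x : ℝ} (hx : 0 < x) (t : ℝ) :
    ContinuousAt (fun p : ℝ × ℝ => pot V n p.1 p.2) (x, t) := by
  obtain ⟨C, hC, h⟩ := exists_eventually_abs_pot_le hV (n + 1) hx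
  obtain ⟨ε, hε, hb⟩ := Metric.eventually_nhds_iff_ball.1 (h.and (lt_mem_nhds hx))
  -- `pot` is Lipschitz in the first variable near `x`, uniformly in the second
  have hL : ∀ y ∈ Metric.ball x ε, ∀ s, ‖pot V n y s - pot V n x s‖ ≤ C * ‖y - x‖ := by
    intro y hy s
    refine (convex_ball x ε).norm_image_sub_le_of_norm_hasDerivWithin_le
      (f := fun y => pot V n y s) (f' := fun y => -pot V (n + 1) y s)
      (fun w hw => (hasDerivAt_pot_space hV n (hb w hw).2 s).hasDerivWithinAt)
      (fun w hw => ?_) (Metric.mem_ball_self hε) hy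
    rw [norm_neg]
    exact (hb w hw).1 s
  have h1 : Tendsto (fun p : ℝ × ℝ => pot V n p.1 p.2 - pot V n x p.2) (𝓝 (x, t)) (𝓝 0) := by
    refine squeeze_zero_norm' (a := fun p : ℝ × ℝ => C * ‖p.1 - x‖) ?_ ?_
    · filter_upwards [continuousAt_fst.eventually (Metric.ball_mem_nhds x hε)] with p hp
      exact hL _ hp _
    · have : Continuous fun p : ℝ × ℝ => C * ‖p.1 - x‖ := by fun_prop
      simpa using this.tendsto (x, t)
  have h2 : Tendsto (fun p : ℝ × ℝ => pot V n x p.2) (𝓝 (x, t)) (𝓝 (pot V n x t)) :=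
    ((continuous_pot hV n hx).comp continuous_snd).tendsto (x, t)
  simpa [ContinuousAt] using h1.add h2

end

/-! ### One-sided convolutions -/

/-- The convolution of two functions supported on the positive half line. -/
theorem convolution_eq_intervalIntegral {f g : ℝ → ℝ} (hf : ∀ τ < 0, f τ = 0)
    (hg : ∀ τ < 0, g τ = 0) {t : ℝ} (ht : 0 ≤ t) :
    (f ⋆[ContinuousLinearMap.mul ℝ ℝ] g) t = ∫ τ in (0 : ℝ)..t, g (t - τ) * f τ := by
  rw [convolution_def, intervalIntegral.integral_of_le ht, ← integral_Icc_eq_integral_Ioc,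
    ← integral_indicator measurableSet_Icc]
  congr 1
  funext τ
  simp only [ContinuousLinearMap.mul_apply']
  by_cases h : τ ∈ Icc 0 t
  · rw [indicator_of_mem h, mul_comm]
  · rw [indicator_of_notMem h]
    rcases lt_or_ge τ 0 with h1 | h1
    · rw [hf τ h1, zero_mul]
    · have : t < τ := by
        by_contra h2
        exact h ⟨h1, not_lt.1 h2⟩
      rw [hg _ (by linarith), mul_zero]

theorem convolution_of_neg {f g : ℝ → ℝ} (hf : ∀ τ < 0, f τ = 0)
    (hg : ∀ τ < 0, g τ = 0) {t : ℝ} (ht : t < 0) :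
    (f ⋆[ContinuousLinearMap.mul ℝ ℝ] g) t = 0 := by
  rw [convolution_def, ← integral_zero ℝ ℝ]
  congr 1
  funext τ
  simp only [ContinuousLinearMap.mul_apply']
  rcases lt_or_ge τ 0 with h | h
  · rw [hf τ h, zero_mul]
  · rw [hg _ (by linarith), mul_zero]

theorem pot_eq_convolution (V : ℝ → ℝ) (n : ℕ) (x : ℝ) :
    pot V n x = V ⋆[ContinuousLinearMap.mul ℝ ℝ] rk n x := rfl

/-- For a density supported on the positive half line, the potential is a one-sided convolution. -/
theorem pot_eq_intervalIntegral {V : ℝ → ℝ} (h0 : ∀ τ < 0, V τ = 0) (n : ℕ) (x : ℝ) {t : ℝ}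
    (ht : 0 ≤ t) : pot V n x t = ∫ τ in (0 : ℝ)..t, rk n x (t - τ) * V τ :=
  convolution_eq_intervalIntegral h0 (fun _ h => rk_of_nonpos _ _ h.le) ht

/-- Convolving a potential with `q` amounts to convolving its kernel with `q`. -/
theorem intervalIntegral_mul_pot {V : ℝ → ℝ} (hV : Integrable V) (h0 : ∀ τ < 0, V τ = 0)
    {q : ℝ → ℝ} (hq : Integrable q) (hq0 : ∀ s < 0, q s = 0) {n m : ℕ} {x y c t : ℝ} (hx : 0 < x)
    (ht : 0 ≤ t)
    (hker : ∀ s, 0 < s → s ≤ t → ∫ σ in (0 : ℝ)..s, q (s - σ) * rk n x σ = c * rk m y s) :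
    ∫ τ in (0 : ℝ)..t, q (t - τ) * pot V n x τ = c * pot V m y t := by
  have hr0 : ∀ m x, ∀ s < 0, rk m x s = 0 := fun m x s h => rk_of_nonpos _ _ h.le
  obtain ⟨C, hC, hb⟩ := exists_abs_rk_le n hx
  have hrc := continuous_rk n hx
  have hbdd : BddAbove (range fun i => ‖‖rk n x i‖‖) :=
    ⟨C, by rintro _ ⟨s, rfl⟩; simpa using hb s⟩
  have hbdd' : BddAbove (range fun i => ‖rk n x i‖) :=
    ⟨C, by rintro _ ⟨s, rfl⟩; simpa using hb s⟩
  have hgk : ∀ s, ConvolutionExistsAt (fun s => ‖rk n x s‖) (fun s => ‖q s‖) s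
      (ContinuousLinearMap.mul ℝ ℝ) volume := by
    intro s
    refine (hq.norm.comp_sub_left s).bdd_mul (c := C) hrc.norm.aestronglyMeasurable
      (Eventually.of_forall fun σ => ?_)
    simpa using hb σ
  have hassoc := convolution_assoc (f := V) (g := rk n x) (k := q) (μ := volume) (ν := volume)
    (ContinuousLinearMap.mul ℝ ℝ) (ContinuousLinearMap.mul ℝ ℝ) (ContinuousLinearMap.mul ℝ ℝ)
    (ContinuousLinearMap.mul ℝ ℝ) (fun a b c => by simp [mul_assoc]) (x₀ := t)
    hV.aestronglyMeasurable hrc.aestronglyMeasurable hq.aestronglyMeasurable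
    (Eventually.of_forall fun s => by
      refine hV.mul_bdd (c := C) ?_ (Eventually.of_forall fun σ => hb _)
      exact (hrc.comp (continuous_const.sub continuous_id)).aestronglyMeasurable)
    (Eventually.of_forall hgk) (by
      have hcont : Continuous ((fun s => ‖rk n x s‖) ⋆[ContinuousLinearMap.mul ℝ ℝ, volume]
          fun s => ‖q s‖) :=
        hbdd.continuous_convolution_left_of_integrable _ hrc.norm hq.norm
      refine hV.norm.mul_bdd (c := ∫ σ, C * ‖q σ‖) ?_ (Eventually.of_forall fun σ => ?_)
      · exact (hcont.comp (continuous_const.sub continuous_id)).aestronglyMeasurable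
      · rw [convolution_def, ← integral_sub_left_eq_self (fun σ => C * ‖q σ‖) volume (t - σ)]
        refine norm_integral_le_of_norm_le ((hq.norm.const_mul C).comp_sub_left _)
          (Eventually.of_forall fun w => ?_)
        simp only [ContinuousLinearMap.mul_apply', norm_mul, norm_norm]
        gcongr
        exact hb w)
  have hpot0 : ∀ τ < 0, pot V n x τ = 0 := fun τ h => convolution_of_neg h0 (hr0 n x) h
  rw [← convolution_eq_intervalIntegral hpot0 hq0 ht, pot_eq_convolution, hassoc, convolution_def,
    pot, ← integral_const_mul]
  congr 1
  funext τ
  simp only [ContinuousLinearMap.mul_apply']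
  rcases lt_or_ge τ 0 with h | h
  · simp [h0 τ h]
  rcases lt_trichotomy (t - τ) 0 with h1 | h1 | h1
  · rw [convolution_of_neg (hr0 n x) hq0 h1, hr0 _ _ _ h1]; simp
  · rw [h1, convolution_eq_intervalIntegral (hr0 n x) hq0 le_rfl, rk_of_nonpos _ _ le_rfl]; simp
  · rw [convolution_eq_intervalIntegral (hr0 n x) hq0 h1.le, hker _ h1 (by linarith)]
    ring

/-! ### Mass, half integral and semigroup property of the kernel -/

theorem heatK_of_nonpos (x : ℝ) {s : ℝ} (hs : s ≤ 0) : heatK x s = 0 := if_neg hs.not_gt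

theorem heatK_nonneg {x : ℝ} (hx : 0 ≤ x) (s : ℝ) : 0 ≤ heatK x s := by
  rcases le_or_gt s 0 with hs | hs
  · rw [heatK_of_nonpos x hs]
  · rw [heatK_of_pos x hs]; positivity

theorem heatK_pos {x s : ℝ} (hx : 0 < x) (hs : 0 < s) : 0 < heatK x s := by
  rw [heatK_of_pos x hs]; positivity

theorem continuous_heatK {x : ℝ} (hx : 0 < x) : Continuous (heatK x) :=
  (continuous_rk 1 hx).congr (rk_one x)

/-- The kernel has total mass one. -/
theorem integral_heatK {x : ℝ} (hx : 0 < x) : ∫ s, heatK x s = 1 := by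
  have h0 : ∫ s in Ioi 0, heatK x s = ∫ s, heatK x s :=
    setIntegral_eq_integral_of_forall_compl_eq_zero fun s hs =>
      heatK_of_nonpos x (not_lt.1 hs)
  have h1 := integral_comp_rpow_Ioi
    (fun y : ℝ => x / √Real.pi * Real.exp (-(x ^ 2 / 4) * y ^ 2)) (p := -(1 / 2)) (by norm_num)
  rw [integral_const_mul, integral_gaussian_Ioi] at h1
  rw [← h0]
  have h2 : x / √Real.pi * (√(Real.pi / (x ^ 2 / 4)) / 2) = 1 := by
    rw [Real.sqrt_div Real.pi_pos.le, Real.sqrt_div (by positivity), Real.sqrt_sq hx.le,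
      show √4 = 2 by rw [show (4 : ℝ) = 2 ^ 2 by norm_num]; exact Real.sqrt_sq (by norm_num)]
    have : √Real.pi ≠ 0 := by positivity
    field_simp
  rw [← h2, ← h1]
  refine setIntegral_congr_fun measurableSet_Ioi fun s (hs : 0 < s) => ?_
  have h3 : s ^ (-(1 / 2) - 1 : ℝ) = (s * √s)⁻¹ := by
    rw [show (-(1 / 2) - 1 : ℝ) = -(1 + 1 / 2) by norm_num, Real.rpow_neg hs.le, Real.rpow_add hs,
      Real.rpow_one, Real.sqrt_eq_rpow]
  have h4 : (s ^ (-(1 / 2) : ℝ)) ^ 2 = s⁻¹ := by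
    rw [← Real.rpow_natCast, ← Real.rpow_mul hs.le]
    norm_num [Real.rpow_neg_one]
  simp only [h3, smul_eq_mul, h4]
  rw [heatK_of_pos x hs, show |(-(1 / 2) : ℝ)| = 1 / 2 by norm_num [abs_of_neg],
    show -(x ^ 2 / 4) * s⁻¹ = -x ^ 2 / (4 * s) by field_simp]
  field_simp

theorem integrable_heatK {x : ℝ} (hx : 0 < x) : Integrable (heatK x) :=
  integrable_of_integral_eq_one (integral_heatK hx)

/-- A primitive of the Gaussian `e^{-cy²}`. -/
noncomputable def gaussPrim (c y : ℝ) : ℝ := ∫ w in (0 : ℝ)..y, Real.exp (-c * w ^ 2)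

theorem hasDerivAt_gaussPrim (c y : ℝ) :
    HasDerivAt (gaussPrim c) (Real.exp (-c * y ^ 2)) y := by
  have : Continuous fun w : ℝ => Real.exp (-c * w ^ 2) := by fun_prop
  exact (this.integral_hasStrictDerivAt 0 y).hasDerivAt

theorem tendsto_gaussPrim_atTop {c : ℝ} (hc : 0 < c) :
    Tendsto (gaussPrim c) atTop (𝓝 (√(Real.pi / c) / 2)) := by
  rw [← integral_gaussian_Ioi]
  exact intervalIntegral_tendsto_integral_Ioi 0
    (integrable_exp_neg_mul_sq hc).integrableOn tendsto_id

theorem tendsto_gaussPrim_atBot {c : ℝ} (hc : 0 < c) :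
    Tendsto (gaussPrim c) atBot (𝓝 (-(√(Real.pi / c) / 2))) := by
  have h : ∀ y, gaussPrim c y = -gaussPrim c (-y) := by
    intro y
    have := intervalIntegral.integral_comp_neg (a := 0) (b := y) (fun w => Real.exp (-c * w ^ 2))
    simp only [neg_sq, neg_zero] at this
    rw [gaussPrim, gaussPrim, this, intervalIntegral.integral_symm]
  rw [funext h]
  exact ((tendsto_gaussPrim_atTop hc).comp tendsto_neg_atBot_atTop).neg

theorem intervalIntegrable_sub_rpow_mul {f : ℝ → ℝ} (hf : Continuous f) (t : ℝ) :
    IntervalIntegrable (fun s => (t - s) ^ (-(1 / 2) : ℝ) * f s) volume 0 t := by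
  have h := (intervalIntegral.intervalIntegrable_rpow' (a := 0) (b := t)
    (r := -(1 / 2)) (by norm_num)).comp_sub_left t
  simp only [sub_zero, sub_self] at h
  exact h.symm.mul_continuousOn hf.continuousOn

theorem rk_zero_of_pos (x : ℝ) {s : ℝ} (hs : 0 < s) :
    rk 0 x s = (√Real.pi)⁻¹ * (√s)⁻¹ * Real.exp (-x ^ 2 / (4 * s)) := by
  rw [rk, hk_zero_ofReal x hs, Complex.ofReal_re]

/-- The substitution `w² = 1/s - 1/t` turns the integral into a Gaussian one. -/
theorem integral_sub_rpow_mul_rk_one {x t : ℝ} (hx : 0 < x) (ht : 0 < t) :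
    ∫ s in (0 : ℝ)..t, (t - s) ^ (-(1 / 2) : ℝ) * rk 1 x s = √Real.pi * rk 0 x t := by
  have hc : 0 < x ^ 2 / 4 := by positivity
  have hpi : √Real.pi ≠ 0 := by positivity
  have hrt : √t ≠ 0 := by positivity
  set κ := x / (√Real.pi * √t) * Real.exp (-x ^ 2 / (4 * t)) with hκ
  have key := intervalIntegral.integral_eq_sub_of_hasDerivAt_of_tendsto ht
    (f := fun s => -κ * gaussPrim (x ^ 2 / 4) (√(1 / s - 1 / t)))
    (f' := fun s => (t - s) ^ (-(1 / 2) : ℝ) * rk 1 x s)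
    (fa := -κ * (√(Real.pi / (x ^ 2 / 4)) / 2)) (fb := 0) ?_
    (intervalIntegrable_sub_rpow_mul (continuous_rk 1 hx) t) ?_ ?_
  · rw [key, rk_zero_of_pos x ht, hκ, Real.sqrt_div Real.pi_pos.le, Real.sqrt_div (by positivity),
      Real.sqrt_sq hx.le,
      show √4 = 2 by rw [show (4 : ℝ) = 2 ^ 2 by norm_num]; exact Real.sqrt_sq (by norm_num)]
    field_simp
    simp
  · intro s hs
    have hs0 : 0 < s := hs.1
    have hts : 0 < t - s := sub_pos.2 hs.2
    have hw : 1 / s - 1 / t = (t - s) / (s * t) := by field_simp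
    have hw0 : 0 < 1 / s - 1 / t := by rw [hw]; positivity
    have h1 : HasDerivAt (fun s : ℝ => √(1 / s - 1 / t))
        (-(s ^ 2)⁻¹ / (2 * √(1 / s - 1 / t))) s := by
      have := ((hasDerivAt_inv hs0.ne').sub_const (1 / t)).sqrt (by simpa using hw0.ne')
      simpa using this
    have h2 := ((hasDerivAt_gaussPrim (x ^ 2 / 4) (√(1 / s - 1 / t))).comp s h1).const_mul (-κ)
    convert! h2 using 1
    rw [Real.sq_sqrt hw0.le, rk_one, heatK_of_pos x hs0, hκ, Real.rpow_neg hts.le,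
      ← Real.sqrt_eq_rpow]
    have he : Real.exp (-x ^ 2 / (4 * s)) =
        Real.exp (-x ^ 2 / (4 * t)) * Real.exp (-(x ^ 2 / 4) * (1 / s - 1 / t)) := by
      rw [← Real.exp_add]; congr 1; field_simp; ring
    rw [he, hw, Real.sqrt_div hts.le, Real.sqrt_mul hs0.le]
    have hrs : √s ≠ 0 := by positivity
    have hrts : √(t - s) ≠ 0 := by positivity
    have hss : √s ^ 2 = s := Real.sq_sqrt hs0.le
    field_simp
    linear_combination -hss
  · have h1 : Tendsto (fun s : ℝ => √(1 / s - 1 / t)) (𝓝[>] 0) atTop := by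
      refine Real.tendsto_sqrt_atTop.comp ?_
      simpa [sub_eq_add_neg] using
        tendsto_atTop_add_const_right _ (-(1 / t)) tendsto_inv_nhdsGT_zero
    exact ((tendsto_gaussPrim_atTop hc).comp h1).const_mul _
  · have h1 : ContinuousAt (fun s : ℝ => -κ * gaussPrim (x ^ 2 / 4) (√(1 / s - 1 / t))) t := by
      refine ContinuousAt.mul continuousAt_const ?_
      refine ContinuousAt.comp (g := gaussPrim (x ^ 2 / 4))
        (hasDerivAt_gaussPrim _ _).continuousAt ?_
      refine Real.continuous_sqrt.continuousAt.comp ?_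
      exact (continuousAt_const.div continuousAt_id ht.ne').sub continuousAt_const
    have h2 := h1.tendsto
    simp only [sub_self, Real.sqrt_zero] at h2
    have h3 : gaussPrim (x ^ 2 / 4) 0 = 0 := by simp [gaussPrim]
    rw [h3, mul_zero] at h2
    exact h2.mono_left nhdsWithin_le_nhds

/-- The half integral lowers the index of the kernel: `J^{1/2} rk (n+1) x = rk n x`. For `n > 0`
this is the case `n = 0` differentiated in `x`. -/
theorem integral_sub_rpow_mul_rk (n : ℕ) {x t : ℝ} (hx : 0 < x) (ht : 0 < t) :
    ∫ s in (0 : ℝ)..t, (t - s) ^ (-(1 / 2) : ℝ) * rk (n + 1) x s = √Real.pi * rk n x t := by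
  induction n generalizing x with
  | zero => exact integral_sub_rpow_mul_rk_one hx ht
  | succ n ih =>
    obtain ⟨C, hC, h⟩ := exists_eventually_abs_rk_le (n + 1 + 1) hx
    have hI := fun (m : ℕ) {y : ℝ} (hy : 0 < y) =>
      intervalIntegrable_sub_rpow_mul (continuous_rk m hy) t
    have hd := (intervalIntegral.hasDerivAt_integral_of_dominated_loc_of_deriv_le (μ := volume)
      (a := 0) (b := t) (x₀ := x)
      (F := fun x s => (t - s) ^ (-(1 / 2) : ℝ) * rk (n + 1) x s)
      (F' := fun x s => -((t - s) ^ (-(1 / 2) : ℝ) * rk (n + 1 + 1) x s))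
      (bound := fun s => (t - s) ^ (-(1 / 2) : ℝ) * C) h ?_ (hI (n + 1) hx)
      ?_ ?_ ?_ ?_).2
    · have hd2 : HasDerivAt (fun x => √Real.pi * rk n x t) (√Real.pi * -rk (n + 1) x t) x :=
        (hasDerivAt_rk_space n x t).const_mul _
      have hd3 := hd2.congr_of_eventuallyEq (f₁ := fun x => ∫ s in (0 : ℝ)..t,
        (t - s) ^ (-(1 / 2) : ℝ) * rk (n + 1) x s) (by
          filter_upwards [lt_mem_nhds hx] with y hy using ih hy)
      have := hd.unique hd3
      rw [intervalIntegral.integral_neg] at this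
      linarith
    · filter_upwards [lt_mem_nhds hx] with y hy
      exact (intervalIntegrable_iff.1 (hI (n + 1) hy)).aestronglyMeasurable
    · exact (intervalIntegrable_iff.1 (hI (n + 1 + 1) hx)).aestronglyMeasurable.neg
    · refine Eventually.of_forall fun s hs y hy => ?_
      rw [uIoc_of_le ht.le] at hs
      have : 0 ≤ (t - s) ^ (-(1 / 2) : ℝ) := Real.rpow_nonneg (by linarith [hs.2]) _
      rw [norm_neg, norm_mul, Real.norm_of_nonneg this]
      gcongr
      exact hy s
    · exact intervalIntegrable_sub_rpow_mul (f := fun _ => C) continuous_const t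
    · refine Eventually.of_forall fun s hs y hy => ?_
      simpa using (hasDerivAt_rk_space (n + 1) y s).const_mul ((t - s) ^ (-(1 / 2) : ℝ))

/-- The convolution semigroup `K(a,·) * K(b,·) = K(a+b,·)`. The integrand has the primitive
`(4πt²)⁻¹ ((a+b) e^{-(a+b)²/(4t)} Φ(y) + (a-b) e^{-(a-b)²/(4t)} Φ(z))`, where `Φ` is a primitive of
`e^{-w²/(4t)}` and `y, z = (bs ∓ a(t-s)) / √(s(t-s))`. -/
theorem integral_heatK_mul_heatK {a b t : ℝ} (ha : 0 < a) (hb : 0 < b) (ht : 0 < t) :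
    ∫ s in (0 : ℝ)..t, heatK b (t - s) * heatK a s = heatK (a + b) t := by
  have hc : 0 < 1 / (4 * t) := by positivity
  have hpi : √Real.pi ≠ 0 := by positivity
  have hpi2 : √Real.pi ^ 2 = Real.pi := Real.sq_sqrt Real.pi_pos.le
  set P := Real.exp (-(a + b) ^ 2 / (4 * t)) with hP
  set M := Real.exp (-(a - b) ^ 2 / (4 * t)) with hM
  set G := √(Real.pi / (1 / (4 * t))) / 2 with hG
  set κ := 1 / (4 * Real.pi * t ^ 2) with hκ
  have hq : ∀ s ∈ Ioo 0 t, 0 < s * (t - s) := fun s hs => mul_pos hs.1 (sub_pos.2 hs.2)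
  -- `1 / √(s (t - s))` blows up at both ends of the interval
  have hq0 : Tendsto (fun s => (√(s * (t - s)))⁻¹) (𝓝[>] 0) atTop := by
    refine tendsto_inv_nhdsGT_zero.comp (tendsto_nhdsWithin_iff.2 ⟨?_, ?_⟩)
    · have : Continuous fun s : ℝ => √(s * (t - s)) := by fun_prop
      simpa using (this.tendsto 0).mono_left nhdsWithin_le_nhds
    · filter_upwards [Ioo_mem_nhdsGT ht] with s hs using Real.sqrt_pos.2 (hq s hs)
  have hqt : Tendsto (fun s => (√(s * (t - s)))⁻¹) (𝓝[<] t) atTop := by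
    refine tendsto_inv_nhdsGT_zero.comp (tendsto_nhdsWithin_iff.2 ⟨?_, ?_⟩)
    · have : Continuous fun s : ℝ => √(s * (t - s)) := by fun_prop
      simpa using (this.tendsto t).mono_left nhdsWithin_le_nhds
    · filter_upwards [Ioo_mem_nhdsLT ht] with s hs using Real.sqrt_pos.2 (hq s hs)
  have hlin : ∀ (σ s₀ : ℝ) (S : Set ℝ), Tendsto (fun s => b * s + σ * (t - s)) (𝓝[S] s₀)
      (𝓝 (b * s₀ + σ * (t - s₀))) := by
    intro σ s₀ S
    have : Continuous fun s : ℝ => b * s + σ * (t - s) := by fun_prop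
    exact (this.tendsto s₀).mono_left nhdsWithin_le_nhds
  have hcont : Continuous fun s => heatK b (t - s) * heatK a s :=
    ((continuous_heatK hb).comp (continuous_const.sub continuous_id)).mul (continuous_heatK ha)
  have key := intervalIntegral.integral_eq_sub_of_hasDerivAt_of_tendsto ht
    (f := fun s => κ *
      ((a + b) * P * gaussPrim (1 / (4 * t)) ((b * s + -a * (t - s)) * (√(s * (t - s)))⁻¹)
      + (a - b) * M * gaussPrim (1 / (4 * t)) ((b * s + a * (t - s)) * (√(s * (t - s)))⁻¹)))
    (f' := fun s => heatK b (t - s) * heatK a s)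
    (fa := κ * ((a + b) * P * (-G) + (a - b) * M * G))
    (fb := κ * ((a + b) * P * G + (a - b) * M * G)) ?_ (hcont.intervalIntegrable 0 t) ?_ ?_
  · rw [key, heatK_of_pos _ ht, ← hP, hκ, hG]
    have : √(Real.pi / (1 / (4 * t))) = 2 * (√Real.pi * √t) := by
      rw [show Real.pi / (1 / (4 * t)) = 2 ^ 2 * (Real.pi * t) by field_simp; norm_num,
        Real.sqrt_mul (by norm_num), Real.sqrt_sq (by norm_num), Real.sqrt_mul Real.pi_pos.le]
    rw [this]
    have hrt : √t ≠ 0 := by positivity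
    have hrt2 : √t ^ 2 = t := Real.sq_sqrt ht.le
    field_simp
    rw [hpi2, hrt2]
    ring
  · intro s hs
    have hs0 : 0 < s := hs.1
    have hts : 0 < t - s := sub_pos.2 hs.2
    have hQ := hq s hs
    set q := √(s * (t - s)) with hqdef
    have hqpos : 0 < q := Real.sqrt_pos.2 hQ
    have hqsq : q ^ 2 = s * (t - s) := Real.sq_sqrt hQ.le
    have hqd : HasDerivAt (fun s => (√(s * (t - s)))⁻¹) (-((t - 2 * s) / (2 * q)) / q ^ 2) s := by
      have h : HasDerivAt (fun s : ℝ => s * (t - s)) (1 * (t - s) + s * -1) s :=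
        (hasDerivAt_id s).mul ((hasDerivAt_id s).const_sub t)
      have h' : HasDerivAt (fun s => (√(s * (t - s)))⁻¹)
          (-((1 * (t - s) + s * -1) / (2 * q)) / q ^ 2) s := (h.sqrt hQ.ne').inv hqpos.ne'
      rwa [show 1 * (t - s) + s * -1 = t - 2 * s by ring] at h'
    have hy : ∀ σ : ℝ, HasDerivAt (fun s => (b * s + σ * (t - s)) * (√(s * (t - s)))⁻¹)
        (t * (b * s - σ * (t - s)) / (2 * q ^ 3)) s := by
      intro σ
      have h' : HasDerivAt (fun s => b * s + σ * (t - s)) (b * 1 + σ * -1) s :=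
        ((hasDerivAt_id s).const_mul b).add (((hasDerivAt_id s).const_sub t).const_mul σ)
      have h : HasDerivAt (fun s => (b * s + σ * (t - s)) * (√(s * (t - s)))⁻¹)
        ((b * 1 + σ * -1) * q⁻¹ + (b * s + σ * (t - s)) * (-((t - 2 * s) / (2 * q)) / q ^ 2)) s :=
        h'.mul hqd
      convert! h using 1
      field_simp
      rw [hqsq]
      ring
    have hd := ((((hasDerivAt_gaussPrim (1 / (4 * t)) _).comp s (hy (-a))).const_mul
      ((a + b) * P)).add
      (((hasDerivAt_gaussPrim (1 / (4 * t)) _).comp s (hy a)).const_mul ((a - b) * M))).const_mul κ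
    convert! hd using 1
    have he1 : P * Real.exp (-(1 / (4 * t)) * ((b * s + -a * (t - s)) * q⁻¹) ^ 2) =
        Real.exp (-b ^ 2 / (4 * (t - s))) * Real.exp (-a ^ 2 / (4 * s)) := by
      rw [hP, ← Real.exp_add, ← Real.exp_add]
      congr 1
      rw [mul_pow, inv_pow, hqsq]
      field_simp
      ring
    have he2 : M * Real.exp (-(1 / (4 * t)) * ((b * s + a * (t - s)) * q⁻¹) ^ 2) =
        Real.exp (-b ^ 2 / (4 * (t - s))) * Real.exp (-a ^ 2 / (4 * s)) := by
      rw [hM, ← Real.exp_add, ← Real.exp_add]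
      congr 1
      rw [mul_pow, inv_pow, hqsq]
      field_simp
      ring
    rw [heatK_of_pos _ hts, heatK_of_pos _ hs0, ← hqdef]
    have hq' : q = √s * √(t - s) := Real.sqrt_mul hs0.le _
    have hrs : √s ≠ 0 := by positivity
    have hrts : √(t - s) ≠ 0 := by positivity
    calc _ = a * b / (4 * √Real.pi ^ 2 * (q ^ 2 * q)) *
          (Real.exp (-b ^ 2 / (4 * (t - s))) * Real.exp (-a ^ 2 / (4 * s))) := by
          rw [hqsq, hq']; field_simp; norm_num
      _ = κ * ((a + b) * (t * (b * s - -a * (t - s)) / (2 * q ^ 3)) +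
          (a - b) * (t * (b * s - a * (t - s)) / (2 * q ^ 3))) *
          (Real.exp (-b ^ 2 / (4 * (t - s))) * Real.exp (-a ^ 2 / (4 * s))) := by
          rw [hpi2, hκ]; congr 1; field_simp; ring
      _ = κ * ((a + b) * (t * (b * s - -a * (t - s)) / (2 * q ^ 3)) *
          (P * Real.exp (-(1 / (4 * t)) * ((b * s + -a * (t - s)) * q⁻¹) ^ 2)) +
          (a - b) * (t * (b * s - a * (t - s)) / (2 * q ^ 3)) *
          (M * Real.exp (-(1 / (4 * t)) * ((b * s + a * (t - s)) * q⁻¹) ^ 2))) := by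
          rw [he1, he2]; ring
      _ = _ := by ring
  · refine (((tendsto_gaussPrim_atBot hc).comp ?_).const_mul _ |>.add
      (((tendsto_gaussPrim_atTop hc).comp ?_).const_mul _)).const_mul _
    · exact (hlin (-a) 0 _).neg_mul_atTop (by simp; positivity) hq0
    · exact (hlin a 0 _).pos_mul_atTop (by simp; positivity) hq0
  · refine (((tendsto_gaussPrim_atTop hc).comp ?_).const_mul _ |>.add
      (((tendsto_gaussPrim_atTop hc).comp ?_).const_mul _)).const_mul _
    · exact (hlin (-a) t _).pos_mul_atTop (by simp; positivity) hqt
    · exact (hlin a t _).pos_mul_atTop (by simp; positivity) hqt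

/-- Half integration in time lowers the index of a potential by one. -/
theorem fracIntegral_half_pot {V : ℝ → ℝ} (hV : Integrable V) (h0 : ∀ τ < 0, V τ = 0) (n : ℕ)
    {x t : ℝ} (hx : 0 < x) (ht : 0 ≤ t) :
    fracIntegral (1 / 2) (pot V (n + 1) x) t = pot V n x t := by
  have hpi : √Real.pi ≠ 0 := by positivity
  -- the kernel `s^{-1/2}` is truncated at `t` to make it integrable on the line
  set q : ℝ → ℝ := (Ioc 0 t).indicator fun s => s ^ (-(1 / 2) : ℝ) with hq
  have hqv : ∀ s r : ℝ, r ≤ t → s ∈ Ioo 0 r → q (r - s) = (r - s) ^ (-(1 / 2) : ℝ) := by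
    intro s r hr hs
    rw [hq, indicator_of_mem]
    exact ⟨by linarith [hs.2], by linarith [hs.1]⟩
  have hcong : ∀ (f : ℝ → ℝ) (r : ℝ), 0 ≤ r → r ≤ t →
      ∫ s in (0 : ℝ)..r, q (r - s) * f s = ∫ s in (0 : ℝ)..r, (r - s) ^ (-(1 / 2) : ℝ) * f s := by
    intro f r h hr
    rw [intervalIntegral.integral_of_le h, intervalIntegral.integral_of_le h,
      integral_Ioc_eq_integral_Ioo, integral_Ioc_eq_integral_Ioo]
    refine setIntegral_congr_fun measurableSet_Ioo fun s hs => ?_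
    simp only [hqv s r hr hs]
  have hqi : Integrable q := by
    have := intervalIntegral.intervalIntegrable_rpow' (a := 0) (b := t) (r := -(1 / 2))
      (by norm_num)
    rw [intervalIntegrable_iff_integrableOn_Ioc_of_le ht] at this
    exact this.integrable_indicator measurableSet_Ioc
  have := intervalIntegral_mul_pot hV h0 hqi
    (fun s hs => by rw [hq, indicator_of_notMem fun h => absurd h.1 (by linarith)])
    (n := n + 1) (m := n) (x := x) (y := x) (c := √Real.pi) hx ht (fun s hs hst => by
      rw [hcong _ s hs.le hst, integral_sub_rpow_mul_rk n hx hs])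
  rw [hcong _ t ht le_rfl] at this
  rw [fracIntegral, show (1 / 2 - 1 : ℝ) = -(1 / 2) by norm_num, this, Real.Gamma_one_half_eq]
  field_simp

/-- The semigroup property at the level of potentials: convolving with `K(h,·)` moves the point from
`x` to `x + h`. -/
theorem integral_heatK_mul_pot {V : ℝ → ℝ} (hV : Integrable V) (h0 : ∀ τ < 0, V τ = 0)
    {x h t : ℝ} (hx : 0 < x) (hh : 0 < h) (ht : 0 ≤ t) :
    ∫ τ in (0 : ℝ)..t, heatK h (t - τ) * pot V 1 x τ = pot V 1 (x + h) t := by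
  have := intervalIntegral_mul_pot hV h0 (integrable_heatK hh)
    (fun s hs => heatK_of_nonpos h hs.le) (n := 1) (m := 1) (x := x) (y := x + h) (c := 1) hx ht
    (fun s hs _ => by
      simp only [rk_one, one_mul]
      exact integral_heatK_mul_heatK hx hh hs)
  rwa [one_mul] at this

/-! ### Injectivity of convolution with a positive kernel -/

/-- If the Laplace transform of `W` decays like `e^{-dp}`, then `W` has integral zero over
`(-∞, b)` for every `b < d`. Only integer multiples `p = n, 2n, 3n, …` are used: the combination
`∑ (-1)^{k-1} e^{knb} / k! · ∫ e^{-knτ} W(τ) dτ = ∫ (1 - exp(-e^{n(b-τ)})) W(τ) dτ`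
tends to `∫_{τ<b} W` as `n → ∞`, and to `0` by the decay. -/
theorem setIntegral_Iio_eq_zero_of_laplace_le {W : ℝ → ℝ} (hW : Integrable W)
    (h0 : ∀ τ < 0, W τ = 0) {C b d : ℝ} (hbd : b < d)
    (hdecay : ∀ p : ℝ, 1 ≤ p → |∫ τ, Real.exp (-p * τ) * W τ| ≤ C * Real.exp (-p * d)) :
    ∫ τ in Iio b, W τ = 0 := by
  have hsumm : ∀ y : ℝ, Summable fun k : ℕ => y ^ (k + 1) / ((k + 1).factorial : ℝ) := fun y =>
    (summable_nat_add_iff (f := fun k : ℕ => y ^ k / (k.factorial : ℝ)) 1).2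
      (Real.summable_pow_div_factorial y)
  have hexp : ∀ y : ℝ, HasSum (fun k : ℕ => y ^ (k + 1) / ((k + 1).factorial : ℝ))
      (Real.exp y - 1) := by
    intro y
    have h : HasSum (fun k : ℕ => y ^ k / (k.factorial : ℝ)) (Real.exp y) := by
      rw [Real.exp_eq_exp_ℝ]
      exact NormedSpace.expSeries_div_hasSum_exp y
    simpa using (hasSum_nat_add_iff' 1).2 h
  let I : ℕ → ℝ := fun n => ∫ τ, (1 - Real.exp (-Real.exp (n * (b - τ)))) * W τ
  have hlim : Tendsto I atTop (𝓝 (∫ τ, (Iio b).indicator W τ)) := by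
    refine tendsto_integral_of_dominated_convergence (fun τ => ‖W τ‖) (fun n => ?_) hW.norm
      (fun n => Eventually.of_forall fun τ => ?_) ?_
    · have : Continuous fun τ : ℝ => 1 - Real.exp (-Real.exp (n * (b - τ))) := by fun_prop
      exact this.aestronglyMeasurable.mul hW.aestronglyMeasurable
    · rw [norm_mul]
      have h1 : Real.exp (-Real.exp (n * (b - τ))) ≤ 1 :=
        Real.exp_le_one_iff.2 (by linarith [Real.exp_pos (n * (b - τ))])
      have h2 := Real.exp_pos (-Real.exp (n * (b - τ)))
      refine mul_le_of_le_one_left (norm_nonneg _) ?_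
      rw [Real.norm_eq_abs, abs_le]
      constructor <;> linarith
    · have hne : ∀ᵐ τ : ℝ, τ ≠ b := by simp [ae_iff]
      filter_upwards [hne] with τ hτ
      rcases lt_or_gt_of_ne hτ with h | h
      · rw [indicator_of_mem (show τ ∈ Iio b from h)]
        have h1 : Tendsto (fun n : ℕ => (n : ℝ) * (b - τ)) atTop atTop :=
          tendsto_natCast_atTop_atTop.atTop_mul_const (sub_pos.2 h)
        have h2 := Real.tendsto_exp_neg_atTop_nhds_zero.comp (Real.tendsto_exp_atTop.comp h1)
        simpa using (h2.const_sub 1).mul_const (W τ)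
      · rw [indicator_of_notMem (show τ ∉ Iio b from not_lt.2 h.le)]
        have h1 : Tendsto (fun n : ℕ => (n : ℝ) * (b - τ)) atTop atBot :=
          tendsto_natCast_atTop_atTop.atTop_mul_const_of_neg (sub_neg.2 h)
        have h2 := (Real.tendsto_exp_atBot.comp h1).neg.rexp
        simpa using (h2.const_sub 1).mul_const (W τ)
  have hbound : ∀ᶠ n : ℕ in atTop, ‖I n‖ ≤ C * (Real.exp (Real.exp (-(n * (d - b)))) - 1) := by
    filter_upwards [eventually_ge_atTop 1] with n hn
    have hn' : (1 : ℝ) ≤ n := by exact_mod_cast hn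
    let F : ℕ → ℝ → ℝ := fun k τ =>
      -((-Real.exp (n * (b - τ))) ^ (k + 1) / ((k + 1).factorial : ℝ)) * W τ
    have hF : ∀ k τ, F k τ = (-(-1) ^ (k + 1) * Real.exp ((k + 1 : ℕ) * (n * b)) /
        ((k + 1).factorial : ℝ)) * (Real.exp (-((k + 1 : ℕ) * n) * τ) * W τ) := by
      intro k τ
      simp only [F]
      rw [neg_pow, ← Real.exp_nat_mul, show ((k + 1 : ℕ) : ℝ) * (n * (b - τ)) =
        ((k + 1 : ℕ) : ℝ) * (n * b) + -((k + 1 : ℕ) * n) * τ by ring, Real.exp_add]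
      ring
    have hle : ∀ k τ, ‖F k τ‖ ≤ (Real.exp (n * b) ^ (k + 1) / ((k + 1).factorial : ℝ)) * ‖W τ‖ := by
      intro k τ
      rcases lt_or_ge τ 0 with h | h
      · simp [F, h0 τ h]
      · simp only [F]
        rw [norm_mul, norm_neg, norm_div, norm_pow, norm_neg,
          Real.norm_of_nonneg (Real.exp_pos _).le, Real.norm_of_nonneg (Nat.cast_nonneg _)]
        gcongr
        linarith
    have hFint : ∀ k, Integrable (F k) := fun k => by
      refine (hW.norm.const_mul _).mono' ?_ (Eventually.of_forall (hle k))
      have : Continuous fun τ : ℝ =>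
          -((-Real.exp (n * (b - τ))) ^ (k + 1) / ((k + 1).factorial : ℝ)) := by fun_prop
      exact this.aestronglyMeasurable.mul hW.aestronglyMeasurable
    have hs : HasSum (fun k => ∫ τ, F k τ) (∫ τ, ∑' k, F k τ) := by
      refine hasSum_integral_of_summable_integral_norm hFint ?_
      refine Summable.of_nonneg_of_le (fun k => integral_nonneg fun τ => norm_nonneg _)
        (fun k => ?_) ((hsumm (Real.exp (n * b))).mul_right (∫ τ, ‖W τ‖))
      rw [← integral_const_mul]
      exact integral_mono (hFint k).norm (hW.norm.const_mul _) (hle k)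
    have hI : ∫ τ, ∑' k, F k τ = I n := by
      congr 1
      funext τ
      have := ((hexp (-Real.exp (n * (b - τ)))).neg.mul_right (W τ)).tsum_eq
      rw [neg_sub] at this
      exact this
    rw [hI] at hs
    have hterm : ∀ k, ‖∫ τ, F k τ‖ ≤
        C * (Real.exp (-(n * (d - b))) ^ (k + 1) / ((k + 1).factorial : ℝ)) := by
      intro k
      simp only [hF]
      rw [integral_const_mul, norm_mul]
      have hp : (1 : ℝ) ≤ (k + 1 : ℕ) * n := by
        have : (1 : ℝ) ≤ (k + 1 : ℕ) := by exact_mod_cast Nat.succ_le_succ (Nat.zero_le k)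
        nlinarith
      have h1 := hdecay _ hp
      have h2 : ‖-(-1 : ℝ) ^ (k + 1) * Real.exp ((k + 1 : ℕ) * (n * b)) / ((k + 1).factorial : ℝ)‖ =
          Real.exp ((k + 1 : ℕ) * (n * b)) / ((k + 1).factorial : ℝ) := by
        rw [norm_div, norm_mul, norm_neg, norm_pow, norm_neg, norm_one, one_pow, one_mul,
          Real.norm_of_nonneg (Real.exp_pos _).le, Real.norm_of_nonneg (Nat.cast_nonneg _)]
      rw [h2]
      calc _ ≤ Real.exp ((k + 1 : ℕ) * (n * b)) / ((k + 1).factorial : ℝ) *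
            (C * Real.exp (-((k + 1 : ℕ) * n) * d)) := by gcongr; exact h1
        _ = _ := by
          rw [← Real.exp_nat_mul, show ((k + 1 : ℕ) : ℝ) * (-(n * (d - b))) =
            ((k + 1 : ℕ) : ℝ) * (n * b) + -((k + 1 : ℕ) * n) * d by ring, Real.exp_add]
          ring
    rw [← hs.tsum_eq]
    exact tsum_of_norm_bounded ((hexp _).mul_left C) hterm
  have hzero : Tendsto I atTop (𝓝 0) := by
    refine squeeze_zero_norm' hbound ?_
    have h1 : Tendsto (fun n : ℕ => -((n : ℝ) * (d - b))) atTop atBot :=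
      tendsto_neg_atTop_atBot.comp (tendsto_natCast_atTop_atTop.atTop_mul_const (sub_pos.2 hbd))
    simpa using (((Real.tendsto_exp_atBot.comp h1).rexp).sub_const 1).const_mul C
  rw [← integral_indicator measurableSet_Iio]
  exact tendsto_nhds_unique hlim hzero

/-- If `W * k` vanishes up to time `T`, where `k` is positive on `(0,∞)`, then the Laplace transform
of `W` decays almost like `e^{-Tp}`, because that of `k` decays more slowly than any `e^{-εp}`. -/
theorem exists_laplace_le_of_convolution_eq_zero {k W : ℝ → ℝ} {T ε : ℝ} (hε : 0 < ε)
    (hk : Continuous k) (hk0 : ∀ s ≤ 0, k s = 0) (hkpos : ∀ s, 0 < s → 0 < k s)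
    (hki : Integrable k) {B : ℝ} (hB : ∀ s, |k s| ≤ B) (hW : Integrable W)
    (hW0 : ∀ τ, W τ ≠ 0 → τ ∈ Icc 0 T)
    (h : ∀ t ≤ T, (W ⋆[ContinuousLinearMap.mul ℝ ℝ] k) t = 0) :
    ∃ C : ℝ, ∀ p : ℝ, 1 ≤ p → |∫ τ, Real.exp (-p * τ) * W τ| ≤ C * Real.exp (-p * (T - ε)) := by
  set f := W ⋆[ContinuousLinearMap.mul ℝ ℝ] k with hf
  set D := ∫ τ, ‖W τ‖ * B with hD
  have hBnn : 0 ≤ B := (abs_nonneg _).trans (hB 0)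
  have hDnn : 0 ≤ D := by positivity
  have hfb : ∀ t, |f t| ≤ D := fun t => by
    rw [hf, convolution_def, ← Real.norm_eq_abs]
    refine norm_integral_le_of_norm_le (hW.norm.mul_const B) (Eventually.of_forall fun τ => ?_)
    simp only [ContinuousLinearMap.mul_apply', norm_mul]
    gcongr
    exact hB _
  have hc : 0 < ∫ s in (0 : ℝ)..ε, k s :=
    intervalIntegral.intervalIntegral_pos_of_pos_on (hk.intervalIntegrable _ _)
      (fun s hs => hkpos s hs.1) hε
  set c := ∫ s in (0 : ℝ)..ε, k s with hcdef
  refine ⟨D / c, fun p hp => ?_⟩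
  have hp0 : 0 < p := by linarith
  have hWp : Integrable fun τ => Real.exp (-p * τ) * W τ := by
    refine hW.norm.mono' ((by fun_prop : Continuous fun τ : ℝ =>
      Real.exp (-p * τ)).aestronglyMeasurable.mul hW.aestronglyMeasurable)
      (Eventually.of_forall fun τ => ?_)
    by_cases hτ : W τ = 0
    · simp [hτ]
    · rw [norm_mul, Real.norm_of_nonneg (Real.exp_pos _).le]
      refine mul_le_of_le_one_left (norm_nonneg _) (Real.exp_le_one_iff.2 ?_)
      nlinarith [(hW0 τ hτ).1]
  have hkp_nonneg : ∀ s, 0 ≤ Real.exp (-p * s) * k s := fun s => by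
    rcases le_or_gt s 0 with hs | hs
    · simp [hk0 s hs]
    · have := hkpos s hs
      positivity
  have hkp : Integrable fun τ => Real.exp (-p * τ) * k τ := by
    refine hki.norm.mono'
      (by fun_prop : Continuous fun τ : ℝ => Real.exp (-p * τ) * k τ).aestronglyMeasurable
      (Eventually.of_forall fun τ => ?_)
    rcases le_or_gt τ 0 with hs | hs
    · simp [hk0 τ hs]
    · rw [norm_mul, Real.norm_of_nonneg (Real.exp_pos _).le]
      refine mul_le_of_le_one_left (norm_nonneg _) (Real.exp_le_one_iff.2 ?_)
      nlinarith
  have hprod := integral_convolution (ContinuousLinearMap.mul ℝ ℝ) hWp hkp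
  have hconv : ((fun τ => Real.exp (-p * τ) * W τ) ⋆[ContinuousLinearMap.mul ℝ ℝ]
      fun τ => Real.exp (-p * τ) * k τ) = fun t => Real.exp (-p * t) * f t := by
    funext t
    rw [hf, convolution_def, convolution_def, ← integral_const_mul]
    congr 1
    funext τ
    simp only [ContinuousLinearMap.mul_apply']
    rw [show -p * t = -p * τ + -p * (t - τ) by ring, Real.exp_add]
    ring
  rw [hconv] at hprod
  -- on `[0,ε]` the weight `e^{-ps}` is at least `e^{-pε}`
  have hkl : c * Real.exp (-p * ε) ≤ ∫ τ, Real.exp (-p * τ) * k τ := by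
    calc c * Real.exp (-p * ε) = ∫ s in Ioc 0 ε, k s * Real.exp (-p * ε) := by
          rw [integral_mul_const, hcdef, intervalIntegral.integral_of_le hε.le]
      _ ≤ ∫ s in Ioc 0 ε, Real.exp (-p * s) * k s := by
          refine setIntegral_mono_on (hki.integrableOn.mul_const _) hkp.integrableOn
            measurableSet_Ioc fun s hs => ?_
          have := (hkpos s hs.1).le
          rw [mul_comm]
          gcongr ?_ * _
          apply Real.exp_le_exp.2
          nlinarith [hs.2]
      _ ≤ _ := setIntegral_le_integral hkp (Eventually.of_forall hkp_nonneg)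
  -- `f` vanishes up to `T` and is bounded, so its Laplace transform is `O(e^{-pT})`
  have hfl : |∫ t, Real.exp (-p * t) * f t| ≤ D * Real.exp (-p * T) := by
    have h1 : |∫ t, Real.exp (-p * t) * f t| ≤
        ∫ t, (Ioi T).indicator (fun t => D * Real.exp (-p * t)) t := by
      rw [← Real.norm_eq_abs]
      refine norm_integral_le_of_norm_le
        (IntegrableOn.integrable_indicator ((exp_neg_integrableOn_Ioi T hp0).const_mul D)
          measurableSet_Ioi)
        (Eventually.of_forall fun t => ?_)
      rcases le_or_gt t T with ht | ht
      · rw [h t ht, indicator_of_notMem (by simpa using ht)]; simp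
      · rw [indicator_of_mem (show t ∈ Ioi T from ht), norm_mul,
          Real.norm_of_nonneg (Real.exp_pos _).le, mul_comm]
        gcongr
        exact hfb t
    refine h1.trans ?_
    rw [integral_indicator measurableSet_Ioi, integral_const_mul,
      integral_exp_mul_Ioi (by linarith)]
    gcongr
    rw [neg_div_neg_eq]
    exact div_le_self (Real.exp_pos _).le hp
  have hmul : |∫ τ, Real.exp (-p * τ) * W τ| * (c * Real.exp (-p * ε)) ≤ D * Real.exp (-p * T) := by
    calc _ ≤ |∫ τ, Real.exp (-p * τ) * W τ| * ∫ τ, Real.exp (-p * τ) * k τ := by gcongr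
      _ = |∫ t, Real.exp (-p * t) * f t| := by
        rw [hprod, ContinuousLinearMap.mul_apply', abs_mul,
          abs_of_nonneg (a := ∫ τ, Real.exp (-p * τ) * k τ) (integral_nonneg hkp_nonneg)]
      _ ≤ _ := hfl
  have he : Real.exp (-p * T) = Real.exp (-p * (T - ε)) * Real.exp (-p * ε) := by
    rw [← Real.exp_add]; congr 1; ring
  rw [he] at hmul
  have he0 := Real.exp_pos (-p * ε)
  rw [div_mul_eq_mul_div, le_div_iff₀ hc]
  refine le_of_mul_le_mul_right ?_ he0
  linarith

/-- Convolution with a positive kernel is injective on continuous functions on `[0,T]`. -/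
theorem eq_zero_of_intervalIntegral_mul_eq_zero {k w : ℝ → ℝ} {T : ℝ} (hT : 0 < T)
    (hk : Continuous k) (hk0 : ∀ s ≤ 0, k s = 0) (hkpos : ∀ s, 0 < s → 0 < k s)
    (hki : Integrable k) {B : ℝ} (hB : ∀ s, |k s| ≤ B) (hw : ContinuousOn w (Icc 0 T))
    (h : ∀ t ∈ Icc 0 T, ∫ τ in (0 : ℝ)..t, k (t - τ) * w τ = 0) :
    ∀ t ∈ Icc 0 T, w t = 0 := by
  set W := (Icc 0 T).indicator w with hWdef
  have hW : Integrable W := hw.integrableOn_Icc.integrable_indicator measurableSet_Icc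
  have hW0 : ∀ τ, W τ ≠ 0 → τ ∈ Icc 0 T := fun τ => mem_of_indicator_ne_zero
  have hWneg : ∀ τ < 0, W τ = 0 := fun τ hτ =>
    indicator_of_notMem (fun h => absurd h.1 (by linarith)) _
  have hconv : ∀ t ≤ T, (convolution W k (ContinuousLinearMap.mul ℝ ℝ) volume) t = 0 := by
    intro t ht
    have hk0' : ∀ s < 0, k s = 0 := fun s hs => hk0 s hs.le
    rcases lt_or_ge t 0 with h1 | h1
    · exact convolution_of_neg hWneg hk0' h1
    · rw [convolution_eq_intervalIntegral hWneg hk0' h1]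
      refine Eq.trans ?_ (h t ⟨h1, ht⟩)
      refine intervalIntegral.integral_congr fun τ hτ => ?_
      rw [uIcc_of_le h1] at hτ
      simp only [hWdef]
      rw [indicator_of_mem (show τ ∈ Icc 0 T from ⟨hτ.1, hτ.2.trans ht⟩)]
  have hprim : ∀ b ∈ Ioo 0 T, ∫ τ in (0 : ℝ)..b, w τ = 0 := by
    intro b hb
    obtain ⟨C, hC⟩ := exists_laplace_le_of_convolution_eq_zero
      (ε := (T - b) / 2) (by linarith [hb.2]) hk hk0 hkpos hki hB hW hW0 hconv
    have h1 := setIntegral_Iio_eq_zero_of_laplace_le hW hWneg (b := b) (by linarith [hb.2]) hC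
    rw [← integral_Iic_eq_integral_Iio] at h1
    refine Eq.trans ?_ h1
    rw [intervalIntegral.integral_of_le hb.1.le, ← integral_Icc_eq_integral_Ioc,
      ← integral_indicator measurableSet_Icc, ← integral_indicator measurableSet_Iic]
    congr 1
    funext τ
    by_cases h2 : τ ∈ Icc 0 b
    · rw [indicator_of_mem h2, indicator_of_mem (show τ ∈ Iic b from h2.2), hWdef,
        indicator_of_mem (show τ ∈ Icc 0 T from ⟨h2.1, h2.2.trans hb.2.le⟩)]
    · rw [indicator_of_notMem h2]
      by_cases h3 : τ ≤ b
      · rw [indicator_of_mem (show τ ∈ Iic b from h3), hWneg τ (not_le.1 fun h4 => h2 ⟨h4, h3⟩)]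
      · rw [indicator_of_notMem (show τ ∉ Iic b from h3)]
  have hopen : EqOn w (fun _ => 0) (Ioo 0 T) := by
    intro b hb
    have hmem : Icc 0 T ∈ 𝓝 b := Icc_mem_nhds hb.1 hb.2
    have hint : IntervalIntegrable w volume 0 b := by
      refine (hw.mono ?_).intervalIntegrable
      rw [uIcc_of_le hb.1.le]
      exact Icc_subset_Icc_right hb.2.le
    have h1 : HasDerivAt (fun b => ∫ τ in (0 : ℝ)..b, w τ) (w b) b :=
      intervalIntegral.integral_hasDerivAt_right hint
        (hw.stronglyMeasurableAtFilter_nhdsWithin measurableSet_Icc b |>.filter_mono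
          (by rw [nhdsWithin_eq_nhds.2 hmem])) (hw.continuousAt hmem)
    have h2 : HasDerivAt (fun b => ∫ τ in (0 : ℝ)..b, w τ) 0 b := by
      refine (hasDerivAt_const b (0 : ℝ)).congr_of_eventuallyEq ?_
      filter_upwards [Ioo_mem_nhds hb.1 hb.2] with y hy using hprim y hy
    exact h1.unique h2
  exact hopen.of_subset_closure hw continuousOn_const Ioo_subset_Icc_self
    (by rw [closure_Ioo hT.ne])

/-! ### The approximate identity -/

theorem heatK_scaling {x : ℝ} (hx : 0 < x) (s : ℝ) :
    heatK x s = (x ^ 2)⁻¹ * heatK 1 ((x ^ 2)⁻¹ * s) := by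
  rcases le_or_gt s 0 with hs | hs
  · rw [heatK_of_nonpos _ hs, heatK_of_nonpos _ (mul_nonpos_of_nonneg_of_nonpos (by positivity) hs),
      mul_zero]
  · rw [heatK_of_pos _ hs, heatK_of_pos _ (by positivity), Real.sqrt_mul (by positivity),
      Real.sqrt_inv, Real.sqrt_sq hx.le]
    have : √s ≠ 0 := by positivity
    have : √Real.pi ≠ 0 := by positivity
    rw [show (-1 ^ 2 : ℝ) / (4 * ((x ^ 2)⁻¹ * s)) = -x ^ 2 / (4 * s) by field_simp]
    field_simp

/-- As `x → 0⁺` the kernels `K(x,·)` form an approximate identity. -/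
theorem tendsto_pot_one_nhdsGT_zero {V : ℝ → ℝ} (hV : Integrable V) {t : ℝ}
    (hVt : ContinuousAt V t) :
    Tendsto (fun x => pot V 1 x t) (𝓝[>] 0) (𝓝 (V t)) := by
  have hdecay : Tendsto (fun s : ℝ => ‖s‖ ^ Module.finrank ℝ ℝ * heatK 1 s)
      (Bornology.cobounded ℝ) (𝓝 0) := by
    have h1 : Tendsto (fun s : ℝ => (√‖s‖)⁻¹) (Bornology.cobounded ℝ) (𝓝 0) :=
      tendsto_inv_atTop_zero.comp (Real.tendsto_sqrt_atTop.comp tendsto_norm_cobounded_atTop)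
    refine squeeze_zero (fun s => mul_nonneg (by positivity) (heatK_nonneg zero_le_one s))
      (fun s => ?_) h1
    rw [Module.finrank_self, pow_one]
    rcases le_or_gt s 0 with hs | hs
    · rw [heatK_of_nonpos _ hs, mul_zero]; positivity
    · rw [heatK_of_pos _ hs, Real.norm_of_nonneg hs.le]
      have hrs : 0 < √s := by positivity
      have h2 : 1 ≤ √Real.pi := Real.one_le_sqrt.2 (by linarith [Real.pi_gt_three])
      have h3 : Real.exp (-1 ^ 2 / (4 * s)) ≤ 1 :=
        Real.exp_le_one_iff.2 (div_nonpos_of_nonpos_of_nonneg (by norm_num) (by positivity))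
      calc s * (1 / (2 * √Real.pi * (s * √s)) * Real.exp (-1 ^ 2 / (4 * s)))
          ≤ s * (1 / (2 * 1 * (s * √s)) * 1) := by gcongr
        _ = (√s)⁻¹ / 2 := by field_simp
        _ ≤ (√s)⁻¹ := half_le_self (by positivity)
  have h := tendsto_integral_comp_smul_smul_of_integrable' (μ := volume) (heatK_nonneg zero_le_one)
    (integral_heatK one_pos) hdecay hV hVt
  have hc : Tendsto (fun x : ℝ => (x ^ 2)⁻¹) (𝓝[>] 0) atTop := by
    refine tendsto_inv_nhdsGT_zero.comp (tendsto_nhdsWithin_iff.2 ⟨?_, ?_⟩)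
    · have : Continuous fun x : ℝ => x ^ 2 := by fun_prop
      simpa using (this.tendsto 0).mono_left nhdsWithin_le_nhds
    · filter_upwards [self_mem_nhdsWithin] with x hx
      have : 0 < x := hx
      exact show (0 : ℝ) < x ^ 2 by positivity
  refine (h.comp hc).congr' ?_
  filter_upwards [self_mem_nhdsWithin] with x hx
  rw [pot]
  refine integral_congr_ae (Eventually.of_forall fun τ => ?_)
  simp only [Module.finrank_self, pow_one, smul_eq_mul]
  rw [rk_one, heatK_scaling hx, mul_comm]

/-! ### Fractional derivatives of the boundary values -/

/-- A function whose successive derivatives on the line are `f 0, f 1, f 2, …` has the same ones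
within any set of unique differentiability. -/
theorem iteratedDerivWithin_eqOn_of_hasDerivAt {f : ℕ → ℝ → ℝ} {s : Set ℝ} (hs : UniqueDiffOn ℝ s)
    (hf : ∀ k t, HasDerivAt (f k) (f (k + 1) t) t) (k : ℕ) :
    EqOn (iteratedDerivWithin k (f 0) s) (f k) s := by
  induction k with
  | zero => intro t _; simp
  | succ k ih =>
    intro t ht
    rw [iteratedDerivWithin_succ, derivWithin_congr ih (ih ht)]
    exact (hf k t).hasDerivWithinAt.derivWithin (hs t ht)

theorem fracIntegral_congr {α T t : ℝ} {φ ψ : ℝ → ℝ} (h : EqOn φ ψ (Icc 0 T)) (ht : t ∈ Icc 0 T) :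
    fracIntegral α φ t = fracIntegral α ψ t := by
  simp only [fracIntegral]
  congr 1
  refine intervalIntegral.integral_congr fun τ hτ => ?_
  rw [uIcc_of_le ht.1] at hτ
  simp only [h ⟨hτ.1, hτ.2.trans ht.2⟩]

theorem fracIntegral_one (φ : ℝ → ℝ) (t : ℝ) : fracIntegral 1 φ t = ∫ τ in (0 : ℝ)..t, φ τ := by
  simp [fracIntegral]

section
variable {V g : ℝ → ℝ} {x₀ T : ℝ} (hV : Integrable V) (h0 : ∀ τ < 0, V τ = 0) (hx₀ : 0 < x₀)
  (hT : 0 < T) (hg : EqOn g (pot V 1 x₀) (Icc 0 T))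
include hV hx₀ hT hg

theorem iteratedDerivWithin_eqOn_pot (k : ℕ) :
    EqOn (iteratedDerivWithin k g (Icc 0 T)) (pot V (2 * k + 1) x₀) (Icc 0 T) := by
  intro t ht
  rw [iteratedDerivWithin_congr hg ht]
  exact iteratedDerivWithin_eqOn_of_hasDerivAt (f := fun k => pot V (2 * k + 1) x₀)
    (uniqueDiffOn_Icc hT) (fun k t => hasDerivAt_pot_time hV (2 * k + 1) hx₀ t) k ht

include h0

/-- `∂_t^{n/2}` raises the index of the potential by `n`. For odd `n`, `J^{1/2}` lowers the index by
one and each `∂_t` raises it by two. -/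
theorem rlDeriv_half_eq_pot (n : ℕ) {t : ℝ} (ht : t ∈ Icc 0 T) :
    rlDeriv T ((n : ℝ) / 2) g t = pot V (n + 1) x₀ t := by
  have hu := uniqueDiffOn_Icc hT
  rcases Nat.even_or_odd' n with ⟨k, rfl | rfl⟩
  · have hn : ((2 * k : ℕ) : ℝ) / 2 = k := by push_cast; ring
    rw [rlDeriv, hn, Nat.floor_natCast, sub_self, zero_add]
    have h1 : EqOn (fracIntegral 1 g) (fun t => ∫ τ in (0 : ℝ)..t, pot V 1 x₀ τ) (Icc 0 T) :=
      fun s hs => by rw [fracIntegral_congr hg hs, fracIntegral_one]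
    rw [iteratedDerivWithin_congr h1 ht]
    refine iteratedDerivWithin_eqOn_of_hasDerivAt hu (k := k + 1)
      (f := fun j => Nat.casesOn j (fun t => ∫ τ in (0 : ℝ)..t, pot V 1 x₀ τ)
        fun j => pot V (2 * j + 1) x₀) (fun j s => ?_) ht
    cases j with
    | zero => exact ((continuous_pot hV 1 hx₀).integral_hasStrictDerivAt 0 s).hasDerivAt
    | succ j => exact hasDerivAt_pot_time hV (2 * j + 1) hx₀ s
  · have hn : ((2 * k + 1 : ℕ) : ℝ) / 2 = k + 1 / 2 := by push_cast; ring
    have hfl : ⌊(k : ℝ) + 1 / 2⌋₊ = k := by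
      rw [Nat.floor_eq_iff (by positivity)]; constructor <;> linarith
    rw [rlDeriv, hn, hfl, show (k : ℝ) - (k + 1 / 2) + 1 = 1 / 2 by ring]
    have h1 : EqOn (fracIntegral (1 / 2) g) (pot V 0 x₀) (Icc 0 T) := fun s hs => by
      rw [fracIntegral_congr hg hs, fracIntegral_half_pot hV h0 0 hx₀ hs.1]
    rw [iteratedDerivWithin_congr h1 ht]
    exact iteratedDerivWithin_eqOn_of_hasDerivAt (f := fun k => pot V (2 * k) x₀) hu
      (fun k t => hasDerivAt_pot_time hV (2 * k) hx₀ t) (k + 1) ht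

theorem caputoDeriv_half_eq_pot (n : ℕ) {t : ℝ} (ht : t ∈ Icc 0 T) :
    caputoDeriv T ((n : ℝ) / 2) g t = pot V (n + 1) x₀ t := by
  rcases Nat.even_or_odd' n with ⟨k, rfl | rfl⟩
  · have hn : ((2 * k : ℕ) : ℝ) / 2 = k := by push_cast; ring
    rw [caputoDeriv, hn, Nat.floor_natCast, sub_self, zero_add,
      fracIntegral_congr (iteratedDerivWithin_eqOn_pot hV hx₀ hT hg (k + 1)) ht, fracIntegral_one,
      intervalIntegral.integral_eq_sub_of_hasDerivAt (f' := pot V (2 * (k + 1) + 1) x₀)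
        (fun s _ => hasDerivAt_pot_time hV (2 * k + 1) hx₀ s)
        ((continuous_pot hV _ hx₀).intervalIntegrable _ _),
      pot_eq_intervalIntegral h0 _ _ le_rfl, intervalIntegral.integral_same, sub_zero]
  · have hn : ((2 * k + 1 : ℕ) : ℝ) / 2 = k + 1 / 2 := by push_cast; ring
    have hfl : ⌊(k : ℝ) + 1 / 2⌋₊ = k := by
      rw [Nat.floor_eq_iff (by positivity)]; constructor <;> linarith
    rw [caputoDeriv, hn, hfl, show (k : ℝ) - (k + 1 / 2) + 1 = 1 / 2 by ring,
      fracIntegral_congr (iteratedDerivWithin_eqOn_pot hV hx₀ hT hg (k + 1)) ht]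
    exact fracIntegral_half_pot hV h0 (2 * k + 2) hx₀ ht.1

end

/-! ### The Taylor series of the potential -/

theorem iteratedDeriv_cpot {V : ℝ → ℝ} (hV : Integrable V) (n : ℕ) {z : ℂ} (hz : z ∈ quarterSector)
    (t : ℝ) : iteratedDeriv n (fun z => cpot V 1 z t) z = (-1) ^ n * cpot V (n + 1) z t := by
  induction n generalizing z with
  | zero => simp
  | succ n ih =>
    have h : iteratedDeriv n (fun z => cpot V 1 z t) =ᶠ[𝓝 z]
        fun z => (-1) ^ n * cpot V (n + 1) z t := by
      filter_upwards [isOpen_quarterSector.mem_nhds hz] with w hw using ih hw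
    rw [iteratedDeriv_succ, h.deriv_eq,
      ((hasDerivAt_cpot_space hV (n + 1) hz t).const_mul _).deriv]
    ring

/-- The Taylor series of the potential at `x₀`, on the disc inscribed in the sector. -/
theorem hasSum_cpot {V : ℝ → ℝ} (hV : Integrable V) {x₀ : ℝ} (hx₀ : 0 < x₀) {z : ℂ}
    (hz : z ∈ Metric.ball (x₀ : ℂ) (x₀ / √2)) (t : ℝ) :
    HasSum (fun n : ℕ => ((pot V (n + 1) x₀ t / (n.factorial : ℝ) : ℝ) : ℂ) * (x₀ - z) ^ n)
      (cpot V 1 z t) := by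
  have hd : DifferentiableOn ℂ (fun z => cpot V 1 z t) (Metric.ball (x₀ : ℂ) (x₀ / √2)) :=
    fun w hw => (hasDerivAt_cpot_space hV 1 (ball_subset_quarterSector hw) t).differentiableAt
      |>.differentiableWithinAt
  have h := Complex.hasSum_taylorSeries_on_ball hd hz
  convert! h using 2 with n
  rw [iteratedDeriv_cpot hV n (ofReal_mem_quarterSector hx₀), cpot_ofReal,
    show (x₀ : ℂ) - z = (-1) * (z - x₀) by ring, mul_pow]
  simp
  ring

theorem hasSum_pot {V : ℝ → ℝ} (hV : Integrable V) {x₀ x : ℝ} (hx₀ : 0 < x₀)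
    (hx : |x - x₀| < x₀ / √2) (t : ℝ) :
    HasSum (fun n : ℕ => pot V (n + 1) x₀ t * (x₀ - x) ^ n / (n.factorial : ℝ)) (pot V 1 x t) := by
  have hz : (x : ℂ) ∈ Metric.ball (x₀ : ℂ) (x₀ / √2) := by
    rw [Metric.mem_ball, dist_eq_norm, ← Complex.ofReal_sub, Complex.norm_real]
    exact hx
  have h := hasSum_cpot hV hx₀ hz t
  rw [cpot_ofReal] at h
  rw [← Complex.hasSum_ofReal]
  convert! h using 2 with n
  push_cast
  ring

/-- If the Taylor series at `x₀` converges at distance `h ≤ x₀`, then it represents the potential at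
all smaller distances: both sides are holomorphic on the intersection of a disc with a sector. -/
theorem tsum_eq_pot {V : ℝ → ℝ} (hV : Integrable V) {x₀ h t S : ℝ} (hh : 0 < h) (hhx : h ≤ x₀)
    (hS : Tendsto (fun N => ∑ n ∈ Finset.range N, pot V (n + 1) x₀ t * h ^ n / (n.factorial : ℝ))
      atTop (𝓝 S)) {y : ℝ} (hy0 : 0 < y) (hy1 : y < 1) :
    ∑' n : ℕ, pot V (n + 1) x₀ t * h ^ n / (n.factorial : ℝ) * y ^ n = pot V 1 (x₀ - h * y) t := by
  have hx₀ : 0 < x₀ := hh.trans_le hhx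
  set f : ℕ → ℝ := fun n => pot V (n + 1) x₀ t * h ^ n / (n.factorial : ℝ) with hf
  obtain ⟨C, hC⟩ : ∃ C, ∀ n, ‖f n‖ ≤ C := by
    have h1 : Tendsto f atTop (𝓝 0) := by
      have := (hS.comp (tendsto_add_atTop_nat 1)).sub hS
      simpa [Function.comp_def, Finset.sum_range_succ] using this
    obtain ⟨C, hC⟩ := (Metric.isBounded_range_of_tendsto f h1).exists_norm_le
    exact ⟨C, fun n => hC _ (mem_range_self n)⟩
  have hC0 : 0 ≤ C := (norm_nonneg _).trans (hC 0)
  set ρ := (y + 1) / 2 with hρ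
  let Φ : ℂ → ℂ := fun w => ∑' n, (f n : ℂ) * w ^ n
  let Ψ : ℂ → ℂ := fun w => cpot V 1 (x₀ - h * w) t
  let U : Set ℂ := Metric.ball 0 ρ ∩ {w | (x₀ : ℂ) - h * w ∈ quarterSector}
  have hUo : IsOpen U := Metric.isOpen_ball.inter (isOpen_quarterSector.preimage (by fun_prop))
  have hUc : Convex ℝ U := by
    refine (convex_ball _ _).inter fun z hz w hw a b ha hb hab => ?_
    have hab' : (a : ℂ) + b = 1 := by exact_mod_cast hab
    have h1 := convex_quarterSector hz hw ha hb hab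
    have h2 : (x₀ : ℂ) - h * (a • z + b • w) = a • ((x₀ : ℂ) - h * z) + b • ((x₀ : ℂ) - h * w) := by
      simp only [Complex.real_smul]
      linear_combination (-(x₀ : ℂ)) * hab'
    exact show (x₀ : ℂ) - h * (a • z + b • w) ∈ quarterSector from h2 ▸ h1
  have hΦ : DifferentiableOn ℂ Φ U := by
    refine Complex.differentiableOn_tsum_of_summable_norm (u := fun n => C * ρ ^ n)
      ((summable_geometric_of_lt_one (by linarith) (by linarith)).mul_left C)
      (fun n => by fun_prop) hUo fun n w hw => ?_
    rw [norm_mul, norm_pow, Complex.norm_real]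
    have : ‖w‖ ≤ ρ := by simpa using (mem_ball_zero_iff.1 hw.1).le
    gcongr
    exact hC n
  have hΨ : DifferentiableOn ℂ Ψ U := fun w hw => by
    refine DifferentiableAt.differentiableWithinAt ?_
    exact (hasDerivAt_cpot_space hV 1 hw.2 t).differentiableAt.comp
      (f := fun w : ℂ => (x₀ : ℂ) - h * w) w
      (by fun_prop)
  have h0U : (0 : ℂ) ∈ U := by
    refine ⟨Metric.mem_ball_self (by linarith), ?_⟩
    simpa using ofReal_mem_quarterSector hx₀
  have hyU : (y : ℂ) ∈ U := by
    refine ⟨?_, ?_⟩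
    · rw [mem_ball_zero_iff, Complex.norm_real, Real.norm_of_nonneg hy0.le]
      linarith
    · have : (x₀ : ℂ) - h * y = ((x₀ - h * y : ℝ) : ℂ) := by push_cast; ring
      exact show (x₀ : ℂ) - h * y ∈ quarterSector from
        this ▸ ofReal_mem_quarterSector (by nlinarith)
  have hev : Φ =ᶠ[𝓝 0] Ψ := by
    have hcont : ContinuousAt (fun w : ℂ => (x₀ : ℂ) - h * w) 0 := by fun_prop
    have hb : Metric.ball (x₀ : ℂ) (x₀ / √2) ∈ 𝓝 ((x₀ : ℂ) - h * 0) := by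
      rw [mul_zero, sub_zero]
      exact Metric.ball_mem_nhds _ (by positivity)
    filter_upwards [hcont.preimage_mem_nhds hb] with w hw
    refine Eq.trans ?_ (hasSum_cpot hV hx₀ hw t).tsum_eq
    refine tsum_congr fun n => ?_
    simp only [hf]
    push_cast
    ring
  have := (hΦ.analyticOnNhd hUo).eqOn_of_preconnected_of_eventuallyEq (hΨ.analyticOnNhd hUo)
    hUc.isPreconnected h0U hev hyU
  simp only [Φ, Ψ] at this
  rw [show (x₀ : ℂ) - h * y = ((x₀ - h * y : ℝ) : ℂ) by push_cast; ring, cpot_ofReal] at this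
  have h3 : ((∑' n, f n * y ^ n : ℝ) : ℂ) = ∑' n, (f n : ℂ) * (y : ℂ) ^ n := by
    push_cast
    rfl
  exact_mod_cast h3.trans this

/-! ### Representation of the solution -/

/-- The extension of `v` from `[0,T]` used as the density: constant on `[T,T+1]` (so that continuity
at `T` is kept), zero elsewhere. -/
noncomputable def extendDensity (T : ℝ) (v : ℝ → ℝ) : ℝ → ℝ :=
  (Icc 0 (T + 1)).indicator fun τ => v (min τ T)

theorem continuousOn_comp_min {T : ℝ} (hT : 0 < T) {v : ℝ → ℝ} (hv : ContinuousOn v (Icc 0 T)) :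
    ContinuousOn (fun τ => v (min τ T)) (Icc 0 (T + 1)) :=
  hv.comp (by fun_prop) fun _ hτ => ⟨le_min hτ.1 hT.le, min_le_right _ _⟩

theorem integrable_extendDensity {T : ℝ} (hT : 0 < T) {v : ℝ → ℝ} (hv : ContinuousOn v (Icc 0 T)) :
    Integrable (extendDensity T v) :=
  (continuousOn_comp_min hT hv).integrableOn_Icc.integrable_indicator measurableSet_Icc

theorem extendDensity_of_neg (T : ℝ) (v : ℝ → ℝ) : ∀ τ < 0, extendDensity T v τ = 0 :=
  fun _ hτ => indicator_of_notMem (fun h => absurd h.1 (not_le.2 hτ)) _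

theorem extendDensity_of_mem {T t : ℝ} (v : ℝ → ℝ) (ht : t ∈ Icc 0 T) :
    extendDensity T v t = v t := by
  rw [extendDensity, indicator_of_mem (show t ∈ Icc 0 (T + 1) from ⟨ht.1, by linarith [ht.2]⟩),
    min_eq_left ht.2]

theorem continuousAt_extendDensity {T t : ℝ} (hT : 0 < T) {v : ℝ → ℝ}
    (hv : ContinuousOn v (Icc 0 T)) (ht : t ∈ Ioc 0 T) : ContinuousAt (extendDensity T v) t := by
  have hmem : Icc 0 (T + 1) ∈ 𝓝 t := Icc_mem_nhds ht.1 (by linarith [ht.2])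
  refine ((continuousOn_comp_min hT hv).continuousAt hmem).congr ?_
  filter_upwards [hmem] with τ hτ
  rw [extendDensity, indicator_of_mem hτ]

/-- The solution of the family of Volterra equations is the heat potential of its own trace at
`x = 0`: this potential solves the equation at each `x` by the semigroup property, and the solution
at each `x` is unique. -/
theorem SolvesVolterra.eq_pot {x₀ T : ℝ} {g : ℝ → ℝ} {u : ℝ → ℝ → ℝ} (hx₀ : 0 < x₀) (hT : 0 < T)
    (hu : SolvesVolterra x₀ T g u) :
    (∀ t ∈ Icc 0 T, g t = pot (extendDensity T (u 0)) 1 x₀ t) ∧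
    ∀ x ∈ Ioo 0 x₀, ∀ t ∈ Icc 0 T, u x t = pot (extendDensity T (u 0)) 1 x t := by
  have hv := hu.cont 0 ⟨le_rfl, hx₀⟩
  set V := extendDensity T (u 0) with hVdef
  have hV : Integrable V := integrable_extendDensity hT hv
  have h0 : ∀ τ < 0, V τ = 0 := extendDensity_of_neg T (u 0)
  have hg : ∀ t ∈ Icc 0 T, g t = pot V 1 x₀ t := by
    intro t ht
    rw [← hu.eqn 0 ⟨le_rfl, hx₀⟩ t ht, pot_eq_intervalIntegral h0 _ _ ht.1]
    refine intervalIntegral.integral_congr fun τ hτ => ?_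
    rw [uIcc_of_le ht.1] at hτ
    simp only [sub_zero, rk_one]
    rw [hVdef, extendDensity_of_mem _ ⟨hτ.1, hτ.2.trans ht.2⟩]
  refine ⟨hg, fun x hx t ht => ?_⟩
  have hh : 0 < x₀ - x := sub_pos.2 hx.2
  obtain ⟨B, -, hB⟩ := exists_abs_rk_le 1 hh
  have hux := hu.cont x ⟨hx.1.le, hx.2⟩
  have hpc := continuous_pot hV 1 hx.1
  have hKc := continuous_heatK hh
  refine sub_eq_zero.1 (eq_zero_of_intervalIntegral_mul_eq_zero
    (w := fun t => u x t - pot V 1 x t) hT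
    hKc (fun s hs => heatK_of_nonpos _ hs) (fun s hs => heatK_pos hh hs) (integrable_heatK hh)
    (B := B) (fun s => rk_one _ s ▸ hB s) (hux.sub hpc.continuousOn) (fun t ht => ?_) t ht)
  have hsub : uIcc 0 t ⊆ Icc 0 T := by
    rw [uIcc_of_le ht.1]; exact Icc_subset_Icc_right ht.2
  simp only [mul_sub]
  have hKc' : Continuous fun τ => heatK (x₀ - x) (t - τ) :=
    hKc.comp (continuous_const.sub continuous_id)
  rw [intervalIntegral.integral_sub, hu.eqn x ⟨hx.1.le, hx.2⟩ t ht,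
    integral_heatK_mul_pot hV h0 hx.1 hh ht.1, hg t ht, show x + (x₀ - x) = x₀ by ring, sub_self]
  · exact (hKc'.continuousOn.mul (hux.mono hsub)).intervalIntegrable
  · exact (hKc'.mul hpc).intervalIntegrable _ _

/-! ### The finite bar -/

theorem mainTheorem2 (x₀ T : ℝ) (hx₀ : 0 < x₀) (hT : 0 < T) (g : ℝ → ℝ) (hg : MemM T g)
    (u : ℝ → ℝ → ℝ) (hu : SolvesVolterra x₀ T g u) (hu₀ : ∀ t ∈ Icc 0 T, u x₀ t = g t) :
    -- the two fractional derivatives of `g` of each order `n / 2` agree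
    (∀ n : ℕ, ∀ t ∈ Icc 0 T, rlDeriv T ((n : ℝ) / 2) g t = caputoDeriv T ((n : ℝ) / 2) g t) ∧
    -- the heat flux at `x₀`: as a one-sided derivative and as a limit of `∂_x u`
    (∀ t ∈ Icc 0 T,
      HasDerivWithinAt (fun x => u x t) (-rlDeriv T (1 / 2) g t) (Iic x₀) x₀ ∧
      (∀ x ∈ Ioo 0 x₀, DifferentiableAt ℝ (fun y => u y t) x) ∧
      Tendsto (fun x => deriv (fun y => u y t) x) (𝓝[<] x₀) (𝓝 (-rlDeriv T (1 / 2) g t))) ∧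
    -- `u` solves the Cauchy problem of the finite bar
    SolvesFiniteBar x₀ T g (fun t => -rlDeriv T (1 / 2) g t) u ∧
    -- the series converges to `u` near `x₀`
    (∀ x t : ℝ, x ≤ x₀ → x₀ - x < x₀ / Real.sqrt 2 → t ∈ Icc 0 T →
      HasSum (halfSeriesTerm x₀ T g x t) (u x t)) ∧
    -- and wherever it converges on the bar, its sum is `u`
    (∀ x ∈ Ico 0 x₀, ∀ t ∈ Icc 0 T, (x, t) ≠ (0, 0) → ∀ S : ℝ,
      Tendsto (fun N => ∑ n ∈ Finset.range N, halfSeriesTerm x₀ T g x t n) atTop (𝓝 S) →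
      u x t = S) := by
  obtain ⟨hgV, huV⟩ := hu.eq_pot hx₀ hT
  have hv := hu.cont 0 ⟨le_rfl, hx₀⟩
  set V := extendDensity T (u 0) with hVdef
  have hV : Integrable V := integrable_extendDensity hT hv
  have h0 : ∀ τ < 0, V τ = 0 := extendDensity_of_neg T (u 0)
  have huI : ∀ x ∈ Ioc 0 x₀, ∀ t ∈ Icc 0 T, u x t = pot V 1 x t := by
    intro x hx t ht
    rcases hx.2.eq_or_lt with rfl | h
    · rw [hu₀ t ht, hgV t ht]
    · exact huV x ⟨hx.1, h⟩ t ht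
  have hrl := fun n t ht => rlDeriv_half_eq_pot hV h0 hx₀ hT hgV n (t := t) ht
  have hhalf : ∀ t ∈ Icc 0 T, rlDeriv T (1 / 2) g t = pot V 2 x₀ t := fun t ht => by
    simpa using hrl 1 t ht
  have hloc : ∀ x ∈ Ioo 0 x₀, ∀ t ∈ Icc 0 T, (fun y => u y t) =ᶠ[𝓝 x] fun y => pot V 1 y t := by
    intro x hx t ht
    filter_upwards [Ioo_mem_nhds hx.1 hx.2] with y hy using huV y hy t ht
  have hder : ∀ x ∈ Ioo 0 x₀, ∀ t ∈ Icc 0 T, HasDerivAt (fun y => u y t) (-pot V 2 x t) x :=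
    fun x hx t ht => (hasDerivAt_pot_space hV 1 hx.1 t).congr_of_eventuallyEq (hloc x hx t ht)
  have hflux : ∀ t ∈ Icc 0 T,
      HasDerivWithinAt (fun x => u x t) (-rlDeriv T (1 / 2) g t) (Iic x₀) x₀ := by
    intro t ht
    rw [hhalf t ht]
    refine (hasDerivAt_pot_space hV 1 hx₀ t).hasDerivWithinAt.congr_of_eventuallyEq ?_
      (huI x₀ ⟨hx₀, le_rfl⟩ t ht)
    filter_upwards [self_mem_nhdsWithin, mem_nhdsWithin_of_mem_nhds (lt_mem_nhds hx₀)] with y hy hy0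
    exact huI y ⟨hy0, hy⟩ t ht
  have hterm : ∀ x, ∀ t ∈ Icc 0 T, halfSeriesTerm x₀ T g x t =
      fun n : ℕ => pot V (n + 1) x₀ t * (x₀ - x) ^ n / (n.factorial : ℝ) := by
    intro x t ht
    funext n
    rw [halfSeriesTerm, hrl n t ht]
  refine ⟨fun n t ht => ?_,
    fun t ht => ⟨hflux t ht, fun x hx => (hder x hx t ht).differentiableAt, ?_⟩,
    ⟨?_, fun x hx t ht => (hder x hx t ht).differentiableAt, ?_, hu₀, hflux, ?_⟩, ?_, ?_⟩
  · rw [hrl n t ht, caputoDeriv_half_eq_pot hV h0 hx₀ hT hgV n ht]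
  · rw [hhalf t ht]
    have h1 : Tendsto (fun x => -pot V 2 x t) (𝓝[<] x₀) (𝓝 (-pot V 2 x₀ t)) :=
      (hasDerivAt_pot_space hV 2 hx₀ t).continuousAt.neg.tendsto.mono_left nhdsWithin_le_nhds
    refine h1.congr' ?_
    filter_upwards [Ioo_mem_nhdsLT hx₀] with x hx using (hder x hx t ht).deriv.symm
  · intro p hp
    refine (continuousAt_pot hV 1 hp.1.1 p.2).continuousWithinAt.congr (fun q hq => ?_) ?_
    · exact huI q.1 hq.1 q.2 hq.2
    · exact huI p.1 hp.1 p.2 hp.2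
  · intro x hx t ht
    refine ⟨pot V 3 x t, ?_, ?_⟩
    · have h1 := (hasDerivAt_pot_space hV 2 hx.1 t).neg
      rw [neg_neg] at h1
      refine h1.congr_of_eventuallyEq ?_
      filter_upwards [Ioo_mem_nhds hx.1 hx.2] with y hy using (hder y hy t ht).deriv
    · exact (hasDerivAt_pot_time hV 1 hx.1 t).hasDerivWithinAt.congr (fun s hs => huV x hx s hs)
        (huV x hx t ht)
  · intro x hx
    rw [huV x hx 0 ⟨le_rfl, hT.le⟩, pot_eq_intervalIntegral h0 _ _ le_rfl,
      intervalIntegral.integral_same]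
  · intro x t hx hxx ht
    have h2 : x₀ / √2 ≤ x₀ := div_le_self hx₀.le (Real.one_le_sqrt.2 (by norm_num))
    rw [huI x ⟨by linarith, hx⟩ t ht, hterm x t ht]
    refine hasSum_pot hV hx₀ ?_ t
    rwa [abs_sub_comm, abs_of_nonneg (sub_nonneg.2 hx)]
  · intro x hx t ht hne S hS
    rw [hterm x t ht] at hS
    have hh : 0 < x₀ - x := sub_pos.2 hx.2
    -- Abel's limit theorem along the segment from `x₀` to `x`
    have habel := Real.tendsto_tsum_powerSeries_nhdsWithin_lt hS
    have hpath : Tendsto (fun y : ℝ => pot V 1 (x₀ - (x₀ - x) * y) t) (𝓝[<] 1) (𝓝 S) := by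
      refine habel.congr' ?_
      filter_upwards [Ioo_mem_nhdsLT one_pos] with y hy
      exact tsum_eq_pot hV hh (by linarith [hx.1]) hS hy.1 hy.2
    have hlin : Tendsto (fun y : ℝ => x₀ - (x₀ - x) * y) (𝓝[<] 1) (𝓝[>] x) := by
      refine tendsto_nhdsWithin_iff.2 ⟨?_, ?_⟩
      · have : Continuous fun y : ℝ => x₀ - (x₀ - x) * y := by fun_prop
        simpa using (this.tendsto 1).mono_left nhdsWithin_le_nhds
      · filter_upwards [self_mem_nhdsWithin] with y hy
        have : y < 1 := hy
        exact show x < x₀ - (x₀ - x) * y by nlinarith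
    refine tendsto_nhds_unique ?_ hpath
    refine Tendsto.comp (g := fun x => pot V 1 x t) ?_ hlin
    rcases hx.1.eq_or_lt with rfl | hx0
    · have ht0 : 0 < t := lt_of_le_of_ne ht.1 fun h => hne (by rw [← h])
      rw [← extendDensity_of_mem (u 0) ht]
      exact tendsto_pot_one_nhdsGT_zero hV (continuousAt_extendDensity hT hv ⟨ht0, ht.2⟩)
    · rw [huV x ⟨hx0, hx.2⟩ t ht]
      exact (hasDerivAt_pot_space hV 1 hx0 t).continuousAt.tendsto.mono_left nhdsWithin_le_nhds
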